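/- All graphs are finite and simple. Let $G$ be a graph, and let $f\colon V(G)\to\{0,1\}$ be *even-sum*, i.e. $\sum_{v\in V(G)} f(v)$ is even. An *$f$-parity perfect forest* of $G$ is a spanning forest $F$ of $G$ such that every tree of $F$ is an induced subgraph of $G$ and $d_F(x)\equiv f(x) \pmod 2$ for every $x\in V(G)$. A vertex $x$ is a *cut-vertex* of $G$ if $G-x$ has more connected components than $G$. **Theorem.** 1. The following problem is solvable in polynomial time: given a graph $G$, an edge $e\in E(G)$ and an even-sum function $f\colon V(G)\to\{0,1\}$, decide whether $G$ has an $f$-parity perfect forest not containing $e$. 2. (Reduction at a cut-vertex.) Let $G$ be connected, $e\in E(G)$, $f$ even-sum, and let $x$ be a cut-vertex of $G$. There is exactly one component $C$ of $G-x$ that contains an endpoint of $e$. Put $G'=G[V(C)\cup\{x\}]$, let $f'(w)=f(w)$ for $w\in V(C)$, and choose $f'(x)\in\{0,1\}$ so that $f'$ is even-sum on $G'$. Then $G'$ is connected, contains the edge $e$, has fewer vertices than $G$, and $G$ has an $f$-parity perfect forest not containing $e$ if and only if $G'$ has an $f'$-parity perfect forest not containing $e$. 3. (No cut-vertex.) Let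 $G$ be connected without cut-vertices (that is, $2$-connected or, since it has an edge, possibly $K_2$), let $e\in E(G)$ and let $f$ be even-sum. Then $G$ has no $f$-parity perfect forest avoiding $e$ if and only if the vertices of $f$-value $1$ are exactly the two endpoints of $e$. Here polynomial time means: some program for a unit-cost random access machine with addition and subtraction (and no multiplication) answers correctly on every input $(G,e,f)$ within a number of steps that is polynomial in the length of the input, where $G$ is given by its order in unary and its adjacency matrix, and $e$ and $f$ by bit vectors. -/

import Mathlib

/-! ## Parity perfect forests -/

section Graphs

variable {V : Type*}

/-- `f : V → {0,1}` is even-sum: the sum of its values over the finite vertex set is even. -/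
def IsEvenSum [Finite V] (f : V → Fin 2) : Prop :=
  Even (∑ᶠ v, (f v : ℕ))

/-- `H` is a semiperfect forest of `G`: a spanning forest of `G` each of whose trees
(connected components) is an induced subgraph of `G`. -/
structure IsSemiperfectForest (G H : SimpleGraph V) : Prop where
  le : H ≤ G
  acyclic : H.IsAcyclic
  induced : ∀ T : H.ConnectedComponent, H.induce T.supp = G.induce T.supp

/-- `H` is an `f`-parity perfect forest of `G`: a semiperfect forest in which the degree of
every vertex `x` has the parity of `f x`. -/
structure IsParityPerfectForest [Finite V] (G : SimpleGraph V) (f : V → Fin 2)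
    (H : SimpleGraph V) : Prop extends IsSemiperfectForest G H where
  parity : ∀ x, (H.neighborSet x).ncard ≡ (f x : ℕ) [MOD 2]

/-- `G` has an `f`-parity perfect forest that does not contain the edge `e`. -/
def HasForestAvoiding [Finite V] (G : SimpleGraph V) (f : V → Fin 2) (e : Sym2 V) : Prop :=
  ∃ H : SimpleGraph V, IsParityPerfectForest G f H ∧ e ∉ H.edgeSet

/-- `x` is a cut-vertex of `G`: `G - x` has more connected components than `G`. -/
def IsCutVertex [Finite V] (G : SimpleGraph V) (x : V) : Prop :=
  Nat.card G.ConnectedComponent < Nat.card (G.induce {x}ᶜ).ConnectedComponent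

/-- For a component `C` of `G - x`, the vertex set `V(C) ∪ {x}`. -/
def attachedSet (G : SimpleGraph V) (x : V) (C : (G.induce {x}ᶜ).ConnectedComponent) : Set V :=
  insert x (Subtype.val '' C.supp)

end Graphs

/-! ## Random access machines and polynomial time

The programs are structured programs for a random access machine with registers `0, 1, 2, …`,
an indirectly addressed memory, addition and truncated subtraction. Every instruction and every
evaluation of a branch or loop condition takes one step. There is no multiplication, so that in
`t` steps the bit length of the stored numbers grows by at most `t`; unit cost on this machine is
therefore polynomially equivalent to time on a Turing machine. -/

namespace Ram

inductive Prog : Type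
  | skip : Prog
  | const (r c : ℕ) : Prog
  | move (r s : ℕ) : Prog
  | add (r s t : ℕ) : Prog
  | sub (r s t : ℕ) : Prog
  | load (r s : ℕ) : Prog
  | store (r s : ℕ) : Prog
  | seq (p q : Prog) : Prog
  | cond (r : ℕ) (p q : Prog) : Prog
  | loop (r : ℕ) (p : Prog) : Prog

structure State : Type where
  reg : ℕ → ℕ
  mem : ℕ → ℕ

/-- The state in which register `r` has been overwritten by the value `a`. -/
def State.setReg (σ : State) (r a : ℕ) : State :=
  { σ with reg := Function.update σ.reg r a }

/-- The state in which the memory cell `i` has been overwritten by the value `a`. -/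
def State.setMem (σ : State) (i a : ℕ) : State :=
  { σ with mem := Function.update σ.mem i a }

/-- `Runs p σ t τ`: started in the state `σ`, the program `p` halts after exactly `t` steps
in the state `τ`. -/
inductive Runs : Prog → State → ℕ → State → Prop
  | skip (σ : State) : Runs .skip σ 1 σ
  | const (r c : ℕ) (σ : State) : Runs (.const r c) σ 1 (σ.setReg r c)
  | move (r s : ℕ) (σ : State) : Runs (.move r s) σ 1 (σ.setReg r (σ.reg s))
  | add (r s t : ℕ) (σ : State) : Runs (.add r s t) σ 1 (σ.setReg r (σ.reg s + σ.reg t))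
  | sub (r s t : ℕ) (σ : State) : Runs (.sub r s t) σ 1 (σ.setReg r (σ.reg s - σ.reg t))
  | load (r s : ℕ) (σ : State) : Runs (.load r s) σ 1 (σ.setReg r (σ.mem (σ.reg s)))
  | store (r s : ℕ) (σ : State) : Runs (.store r s) σ 1 (σ.setMem (σ.reg r) (σ.reg s))
  | seq {p q : Prog} {σ τ υ : State} {a b : ℕ} :
      Runs p σ a τ → Runs q τ b υ → Runs (.seq p q) σ (a + b) υ
  | cond_pos {r : ℕ} {p q : Prog} {σ τ : State} {a : ℕ} :
      σ.reg r ≠ 0 → Runs p σ a τ → Runs (.cond r p q) σ (a + 1) τ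
  | cond_zero {r : ℕ} {p q : Prog} {σ τ : State} {a : ℕ} :
      σ.reg r = 0 → Runs q σ a τ → Runs (.cond r p q) σ (a + 1) τ
  | loop_pos {r : ℕ} {p : Prog} {σ τ υ : State} {a b : ℕ} :
      σ.reg r ≠ 0 → Runs p σ a τ → Runs (.loop r p) τ b υ → Runs (.loop r p) σ (a + b + 1) υ
  | loop_zero {r : ℕ} {p : Prog} {σ : State} :
      σ.reg r = 0 → Runs (.loop r p) σ 1 σ

/-- The machine is deterministic: running time and final state are determined by the program
and the initial state. -/
theorem Runs.deterministic {p : Prog} {σ τ τ' : State} {a a' : ℕ}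
    (h : Runs p σ a τ) (h' : Runs p σ a' τ') : a = a' ∧ τ = τ' := by
  induction h generalizing a' τ' with
  | seq _ _ ih₁ ih₂ =>
    cases h' with
    | seq k₁ k₂ =>
      obtain ⟨rfl, rfl⟩ := ih₁ k₁
      obtain ⟨rfl, rfl⟩ := ih₂ k₂
      exact ⟨rfl, rfl⟩
  | cond_pos hr _ ih =>
    cases h' with
    | cond_pos _ k => obtain ⟨rfl, rfl⟩ := ih k; exact ⟨rfl, rfl⟩
    | cond_zero k _ => exact absurd k hr
  | cond_zero hr _ ih =>
    cases h' with
    | cond_pos k _ => exact absurd hr k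
    | cond_zero _ k => obtain ⟨rfl, rfl⟩ := ih k; exact ⟨rfl, rfl⟩
  | loop_pos hr _ _ ih₁ ih₂ =>
    cases h' with
    | loop_pos _ k₁ k₂ =>
      obtain ⟨rfl, rfl⟩ := ih₁ k₁
      obtain ⟨rfl, rfl⟩ := ih₂ k₂
      exact ⟨rfl, rfl⟩
    | loop_zero k => exact absurd k hr
  | loop_zero hr =>
    cases h' with
    | loop_pos k _ _ => exact absurd hr k
    | loop_zero _ => exact ⟨rfl, rfl⟩
  | _ => cases h'; exact ⟨rfl, rfl⟩

/-- The initial state on the input word `w`: its bits are stored in the memory cells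
`0, …, |w| - 1`, its length in register `0`, and everything else is `0`. -/
def initial (w : List Bool) : State where
  reg r := if r = 0 then w.length else 0
  mem i := (w.getD i false).toNat

/-- The decision problem `P` over the instances `α`, encoded as bit strings by `enc`, is solvable
in polynomial time: one program halts on every instance within a number of steps that is
polynomial in the length of the encoding, with `1` in register `0` if the answer is "yes" and
with `0` in register `0` if the answer is "no". -/
def PolyTimeDecidable {α : Type} (enc : α → List Bool) (P : α → Prop) : Prop :=
  ∃ (p : Prog) (q : Polynomial ℕ), ∀ a : α, ∃ (t : ℕ) (τ : State),
    Runs p (initial (enc a)) t τ ∧ t ≤ q.eval (enc a).length ∧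
      (P a → τ.reg 0 = 1) ∧ (¬ P a → τ.reg 0 = 0)

end Ram

/-! ## The decision problem -/

/-- An instance: a finite graph, an edge of it and an even-sum function on its vertices. -/
structure ForestInstance : Type where
  n : ℕ
  graph : SimpleGraph (Fin n)
  edge : Sym2 (Fin n)
  edge_mem : edge ∈ graph.edgeSet
  f : Fin n → Fin 2
  evenSum : IsEvenSum f

open Classical in
/-- The encoding of an instance: the order `n` in unary, the adjacency matrix row by row,
the incidence vector of the edge, and the values of `f`. -/
noncomputable def ForestInstance.encode (I : ForestInstance) : List Bool :=
  List.replicate I.n true ++ [false]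
    ++ (List.finRange I.n).flatMap
        (fun i => (List.finRange I.n).map fun j => decide (I.graph.Adj i j))
    ++ (List.finRange I.n).map (fun i => decide (i ∈ I.edge))
    ++ (List.finRange I.n).map (fun i => decide (I.f i = 1))

namespace ParityForest

open scoped Classical symmDiff

/-! Degree parities are additive over `ZMod 2` under symmetric difference. By
`hasForestAvoiding_iff`, a forest avoiding `uv` exists exactly when some subgraph with the
prescribed parities leaves `u` and `v` in different components (`Separable`). If `u` and `v` lay in
one induced tree, that tree would contain `uv`. Conversely, take a separating subgraph with fewest
edges: a cycle could be removed, and a missing edge inside a component could replace at least two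
edges, so it is a forest with induced trees.

Prescribed parities are realizable as soon as every component has even sum (`exists_degParity_eq`).
Without cut-vertices it therefore suffices to split the vertices into two connected sides of even
sum with `u` and `v` apart. `exists_connectedOn_insert` lets the side of `u` grow one vertex at a
time, and this succeeds unless `u` and `v` are the only vertices of value one; in that case the
handshake lemma forbids separation. If a part containing `u` and `v` meets the rest only in `x`, the
rest affects the question only through the parity it imposes at `x` (`AttachedAt.separable_iff`).

For the algorithm the recursion is unfolded into one closed test, `Criterion`. The vertices that no
other vertex separates from the edge form its block, and the value that repeated reduction leaves at
such an `x` is the sum over `x` and everything that `x` cuts off from the edge. The test asks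
whether one of these values differs from that of `endpoints`. Separability and the test are both
invariant under reduction, so `separable_iff_criterion` follows by induction on the order. The test
uses only reachability and parities; the combinators around `Ctx.Computes` turn it into nested loops
of `n` rounds, with vertex sets held as bit masks in single registers. -/

theorem reachable_of_adj_reachable {V W : Type*} {J : SimpleGraph V} {K' : SimpleGraph W}
    (r : V → W) (h : ∀ a b, J.Adj a b → K'.Reachable (r a) (r b)) {a b : V}
    (hab : J.Reachable a b) : K'.Reachable (r a) (r b) := by
  obtain ⟨p⟩ := hab
  induction p with
  | nil => exact SimpleGraph.Reachable.refl _
  | cons hadj _ ih => exact (h _ _ hadj).trans ih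

/-! ### Degree parities -/

section Parity

variable {V : Type*} [Fintype V]

/-- The parity of the degree of `x` in `J`. -/
noncomputable def degParity (J : SimpleGraph V) (x : V) : ZMod 2 :=
  ∑ y, if J.Adj x y then 1 else 0

theorem degParity_eq_ncard (J : SimpleGraph V) (x : V) :
    degParity J x = ((J.neighborSet x).ncard : ZMod 2) := by
  rw [degParity, Finset.sum_boole, Set.ncard_eq_toFinset_card']
  congr 2
  ext y
  simp

theorem degParity_eq_iff (J : SimpleGraph V) (x : V) (a : Fin 2) :
    degParity J x = ((a : ℕ) : ZMod 2) ↔ (J.neighborSet x).ncard ≡ (a : ℕ) [MOD 2] := by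
  rw [degParity_eq_ncard, ZMod.natCast_eq_natCast_iff]

theorem degParity_symmDiff (J K : SimpleGraph V) (x : V) :
    degParity (J ∆ K) x = degParity J x + degParity K x := by
  simp only [degParity, ← Finset.sum_add_distrib]
  refine Finset.sum_congr rfl fun y _ => ?_
  have : (J ∆ K).Adj x y ↔ (J.Adj x y ∧ ¬ K.Adj x y) ∨ (K.Adj x y ∧ ¬ J.Adj x y) := by
    simp [symmDiff_def, SimpleGraph.sup_adj, SimpleGraph.sdiff_adj]
  by_cases h₁ : J.Adj x y <;> by_cases h₂ : K.Adj x y <;> simp [this, h₁, h₂]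
  decide

theorem degParity_edge {a b : V} (hab : a ≠ b) (x : V) :
    degParity (SimpleGraph.edge a b) x = (if x = a then 1 else 0) + (if x = b then 1 else 0) := by
  have h : ∀ y, (SimpleGraph.edge a b).Adj x y ↔ (x = a ∧ y = b) ∨ (x = b ∧ y = a) := by
    intro y
    rw [SimpleGraph.edge_adj]
    constructor
    · rintro ⟨h, -⟩; tauto
    · rintro (⟨rfl, rfl⟩ | ⟨rfl, rfl⟩)
      · exact ⟨by tauto, hab⟩
      · exact ⟨by tauto, hab.symm⟩
  simp only [degParity, h]
  by_cases h₁ : x = a <;> by_cases h₂ : x = b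
  · exact absurd (h₁.symm.trans h₂) hab
  all_goals simp [h₁, h₂, hab, hab.symm]

theorem degParity_sum_eq_zero (J : SimpleGraph V) (A : Finset V)
    (hA : ∀ a ∈ A, ∀ b, J.Adj a b → b ∈ A) : ∑ x ∈ A, degParity J x = 0 := by
  have h : ∀ x ∈ A, degParity J x = ∑ y ∈ A, if J.Adj x y then 1 else 0 := by
    intro x hx
    rw [degParity]
    refine (Finset.sum_subset (Finset.subset_univ A) fun y _ hy => ?_).symm
    exact if_neg fun hxy => hy (hA x hx y hxy)
  rw [Finset.sum_congr rfl h, ← Finset.sum_product']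
  refine Finset.sum_involution (fun p _ => p.swap) ?_ ?_ ?_ ?_
  · rintro ⟨p, q⟩ -
    by_cases hpq : J.Adj p q
    · simp only [Prod.swap_prod_mk, hpq, hpq.symm, if_true]
      decide
    · have : ¬ J.Adj q p := fun h => hpq h.symm
      simp [hpq, this]
  · rintro ⟨p, q⟩ - hpq heq
    simp only [Prod.swap_prod_mk, Prod.mk.injEq] at heq
    obtain ⟨rfl, -⟩ := heq
    simp at hpq
  · rintro ⟨p, q⟩ h
    simp only [Finset.mem_product, Prod.swap_prod_mk] at h ⊢
    exact h.symm
  · rintro ⟨p, q⟩ -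
    rfl

theorem degParity_sum_univ (J : SimpleGraph V) : ∑ x, degParity J x = 0 :=
  degParity_sum_eq_zero J Finset.univ fun _ _ _ _ => Finset.mem_univ _

/-- Add up the edges of a walk modulo two: every visit to an inner vertex contributes twice and
cancels. Repeated edges do no harm, so no path has to be extracted, and for `a = b` the prescribed
values vanish. -/
theorem exists_degParity_of_reachable {J : SimpleGraph V} {a b : V} (h : J.Reachable a b) :
    ∃ K ≤ J, ∀ x, degParity K x = (if x = a then 1 else 0) + (if x = b then 1 else 0) := by
  obtain ⟨p⟩ := h
  induction p with
  | nil =>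
    refine ⟨⊥, bot_le, fun x => ?_⟩
    simp only [degParity, SimpleGraph.bot_adj, if_false, Finset.sum_const_zero]
    split_ifs <;> decide
  | @cons a c b hadj _ ih =>
    obtain ⟨K, hK, hd⟩ := ih
    refine ⟨K ∆ SimpleGraph.edge a c, ?_, fun x => ?_⟩
    · refine symmDiff_le_sup.trans (sup_le hK ?_)
      exact (SimpleGraph.edge_le_iff _).2 (Or.inr hadj)
    · rw [degParity_symmDiff, hd, degParity_edge hadj.ne]
      have : ∀ α β γ : ZMod 2, α + β + (γ + α) = γ + β := by decide
      exact this _ _ _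

/-- Every component of `G` has an even sum of `g`-values. -/
def ComponentsEven (G : SimpleGraph V) (g : V → ZMod 2) : Prop :=
  ∀ s, ∑ w with G.Reachable s w, g w = 0

/-- Take a subgraph with the fewest wrong vertices. Two wrong vertices in one component of `G` could
both be repaired by flipping along a walk between them, and a wrong vertex is never alone in its
component. -/
theorem exists_degParity_eq {G : SimpleGraph V} {g : V → ZMod 2} (h : ComponentsEven G g) :
    ∃ J ≤ G, ∀ x, degParity J x = g x := by
  obtain ⟨J, hJ, hmin⟩ := Set.exists_min_image {J : SimpleGraph V | J ≤ G}
    (fun J => {x | degParity J x ≠ g x}.ncard) (Set.toFinite _)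
    ⟨⊥, (bot_le : ⊥ ≤ G)⟩
  refine ⟨J, hJ, ?_⟩
  by_contra! hbad
  obtain ⟨a, ha⟩ := hbad
  -- Both `degParity J` and `g` sum to zero over the component of `a`, so the discrepancies cannot
  -- be concentrated at `a`.
  obtain ⟨b, hab, hb, hne⟩ : ∃ b, G.Reachable a b ∧ degParity J b ≠ g b ∧ b ≠ a := by
    by_contra! hcon
    have h₁ := degParity_sum_eq_zero J (Finset.univ.filter fun w => G.Reachable a w) (by
      intro c hc d hcd
      simp only [Finset.mem_filter, Finset.mem_univ, true_and] at hc ⊢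
      exact hc.trans (hJ hcd).reachable)
    have h₂ : ∑ w with G.Reachable a w, (degParity J w - g w) = 0 := by
      rw [Finset.sum_sub_distrib, h₁, h a, sub_zero]
    rw [Finset.sum_eq_single a] at h₂
    · exact ha (sub_eq_zero.1 h₂)
    · intro b hb hba
      simp only [Finset.mem_filter, Finset.mem_univ, true_and] at hb
      by_contra hb'
      exact hba (hcon b hb (sub_ne_zero.1 hb'))
    · simp
  obtain ⟨K, hK, hd⟩ := exists_degParity_of_reachable hab
  have hJK : J ∆ K ≤ G := symmDiff_le_sup.trans (sup_le hJ hK)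
  refine absurd (hmin _ hJK) (not_le.2 ?_)
  refine Set.ncard_lt_ncard ?_ (Set.toFinite _)
  rw [Set.ssubset_iff_of_subset]
  · refine ⟨a, ha, ?_⟩
    simp only [Set.mem_ofPred_eq, not_not, degParity_symmDiff, hd, if_true, if_neg hne.symm]
    revert ha
    generalize degParity J a = p
    generalize g a = q
    revert p q
    decide
  · intro x hx
    simp only [Set.mem_ofPred_eq, degParity_symmDiff, hd] at hx ⊢
    by_cases hxa : x = a
    · rw [hxa]; exact ha
    by_cases hxb : x = b
    · rw [hxb]; exact hb
    simpa [hxa, hxb] using hx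

theorem componentsEven_of_degParity {G J : SimpleGraph V} {g : V → ZMod 2} (hJ : J ≤ G)
    (h : ∀ x, degParity J x = g x) : ComponentsEven G g := by
  intro s
  rw [← degParity_sum_eq_zero J (Finset.univ.filter fun w => G.Reachable s w)]
  · exact Finset.sum_congr rfl fun x _ => (h x).symm
  · intro c hc d hcd
    simp only [Finset.mem_filter, Finset.mem_univ, true_and] at hc ⊢
    exact hc.trans (hJ hcd).reachable

theorem sum_eq_zero_of_componentsEven {G : SimpleGraph V} {g : V → ZMod 2}
    (h : ComponentsEven G g) : ∑ x, g x = 0 := by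
  obtain ⟨J, -, hJ⟩ := exists_degParity_eq h
  rw [← degParity_sum_univ J]
  exact Finset.sum_congr rfl fun x _ => (hJ x).symm

theorem componentsEven_of_connected {G : SimpleGraph V} {g : V → ZMod 2} (hG : G.Connected)
    (h : ∑ x, g x = 0) : ComponentsEven G g := by
  intro s
  rw [← h]
  congr 1
  ext w
  simpa using hG.preconnected s w

/-- `G` has a subgraph with the degree parities `g` in which `u` and `v` are not connected. -/
def Separable (G : SimpleGraph V) (g : V → ZMod 2) (u v : V) : Prop :=
  ∃ J ≤ G, (∀ x, degParity J x = g x) ∧ ¬ J.Reachable u v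

/-- The values of `f` modulo two. -/
def residue (f : V → Fin 2) (x : V) : ZMod 2 := ((f x : ℕ) : ZMod 2)

theorem isEvenSum_iff (f : V → Fin 2) : IsEvenSum f ↔ ∑ x, residue f x = 0 := by
  rw [IsEvenSum, finsum_eq_sum_of_fintype]
  simp only [residue]
  rw [← Nat.cast_sum, ZMod.natCast_eq_zero_iff, even_iff_two_dvd]

/-- Replace a connection `K` between `a` and `b` inside `J` by the single edge `ab`. Parities do not
change, and since `a` and `b` were already connected no components of `J` are merged. This is what
forces the trees of a minimal subgraph to be induced. -/
theorem exists_shorter {G J : SimpleGraph V} {a b : V} (hJ : J ≤ G) (hG : G.Adj a b)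
    (hab : ¬ J.Adj a b) (h : J.Reachable a b) :
    ∃ J' ≤ G, (∀ x, degParity J' x = degParity J x) ∧
      (∀ p q, J'.Adj p q → J.Reachable p q) ∧ J'.edgeSet.ncard < J.edgeSet.ncard := by
  obtain ⟨K, hK, hd⟩ := exists_degParity_of_reachable h
  have hne := hG.ne
  have hKab : ¬ K.Adj a b := fun h => hab (hK h)
  have hnbr : ∀ x, degParity K x ≠ 0 → ∃ y, K.Adj x y := by
    intro x hx
    by_contra! hcon
    exact hx (by simp [degParity, hcon])
  -- `K` has odd degree at `a` and at `b`, hence an edge at each. These edges differ because `ab` is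
  -- not in `K`, so two edges are lost and at most one is gained.
  obtain ⟨c, hc⟩ := hnbr a (by simp [hd, hne])
  obtain ⟨d, hdd⟩ := hnbr b (by simp [hd, hne.symm])
  refine ⟨(J ∆ K) ∆ SimpleGraph.edge a b, ?_, ?_, ?_, ?_⟩
  · refine symmDiff_le_sup.trans (sup_le (symmDiff_le_sup.trans (sup_le hJ (hK.trans hJ))) ?_)
    exact (SimpleGraph.edge_le_iff _).2 (Or.inr hG)
  · intro x
    rw [degParity_symmDiff, degParity_symmDiff, hd, degParity_edge hne]
    have : ∀ α β γ : ZMod 2, γ + (α + β) + (α + β) = γ := by decide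
    exact this _ _ _
  · intro p q hpq
    have h₁ : (J ⊔ SimpleGraph.edge a b).Adj p q :=
      symmDiff_le_sup.trans (sup_le_sup_right (symmDiff_le_sup.trans (sup_le le_rfl hK)) _) hpq
    rcases h₁ with h₁ | h₁
    · exact h₁.reachable
    · rw [SimpleGraph.edge_adj] at h₁
      rcases h₁.1 with ⟨rfl, rfl⟩ | ⟨rfl, rfl⟩
      · exact h
      · exact h.symm
  · have hsub : ((J ∆ K) ∆ SimpleGraph.edge a b).edgeSet ⊆
        insert s(a, b) (J.edgeSet \ {s(a, c), s(b, d)}) := by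
      intro e
      induction e using Sym2.ind with
      | _ p q =>
      intro hpq
      rw [SimpleGraph.mem_edgeSet] at hpq
      by_cases hE : s(p, q) = s(a, b)
      · exact Or.inl hE
      right
      have h₁ : ¬ (SimpleGraph.edge a b).Adj p q := by
        rw [SimpleGraph.edge_adj]
        rintro ⟨h, -⟩
        apply hE
        rw [Sym2.eq_iff]
        tauto
      have h₂ : (J ∆ K).Adj p q := by
        rw [symmDiff_def] at hpq
        rcases hpq with h | h
        · exact h.1
        · exact absurd h.1 h₁
      have h₃ : J.Adj p q ∧ ¬ K.Adj p q := by
        rw [symmDiff_def] at h₂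
        rcases h₂ with h | h
        · exact h
        · exact absurd (hK h.1) h.2
      refine ⟨h₃.1, ?_⟩
      rintro (h | h)
      · exact h₃.2 (by rw [← SimpleGraph.mem_edgeSet, h]; exact hc)
      · exact h₃.2 (by rw [← SimpleGraph.mem_edgeSet, h]; exact hdd)
    have hcd : s(a, c) ≠ s(b, d) := by
      intro h
      rw [Sym2.eq_iff] at h
      rcases h with ⟨h, -⟩ | ⟨-, rfl⟩
      · exact hne h
      · exact hKab hc
    have h2 : ({s(a, c), s(b, d)} : Set (Sym2 V)) ⊆ J.edgeSet := by
      rintro _ (rfl | rfl)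
      · exact hK hc
      · exact hK hdd
    have h3 := Set.ncard_sdiff_add_ncard_of_subset h2 (Set.toFinite _)
    rw [Set.ncard_pair hcd] at h3
    have h4 := (Set.ncard_le_ncard hsub (Set.toFinite _)).trans (Set.ncard_insert_le _ _)
    omega

/-- An edge `ab` that is not a bridge closes up with a connection of `a` and `b` in the rest of `J`
to an even subgraph; removing that subgraph keeps all parities and deletes `ab`. -/
theorem exists_shorter_of_not_isAcyclic {J : SimpleGraph V} (h : ¬ J.IsAcyclic) :
    ∃ J' ≤ J, (∀ x, degParity J' x = degParity J x) ∧ J'.edgeSet.ncard < J.edgeSet.ncard := by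
  rw [SimpleGraph.isAcyclic_iff_forall_adj_isBridge] at h
  push Not at h
  obtain ⟨a, b, hab, hbr⟩ := h
  rw [SimpleGraph.isBridge_iff] at hbr
  push Not at hbr
  obtain ⟨K, hK, hd⟩ := exists_degParity_of_reachable hbr
  have hKab : ¬ K.Adj a b := fun h => by simpa using hK h
  have hKJ : K ≤ J := hK.trans sdiff_le
  have hle : (J ∆ K) ∆ SimpleGraph.edge a b ≤ J :=
    symmDiff_le_sup.trans (sup_le (symmDiff_le_sup.trans (sup_le le_rfl hKJ))
      ((SimpleGraph.edge_le_iff _).2 (Or.inr hab)))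
  refine ⟨_, hle, ?_, ?_⟩
  · intro x
    rw [degParity_symmDiff, degParity_symmDiff, hd, degParity_edge hab.ne]
    have : ∀ α β γ : ZMod 2, γ + (α + β) + (α + β) = γ := by decide
    exact this _ _ _
  · refine Set.ncard_lt_ncard ?_ (Set.toFinite _)
    rw [Set.ssubset_iff_of_subset (SimpleGraph.edgeSet_mono hle)]
    refine ⟨s(a, b), hab, fun h => ?_⟩
    rw [SimpleGraph.mem_edgeSet] at h
    simp [symmDiff_def, SimpleGraph.edge_adj, hab, hKab, hab.ne] at h

/-- This removes forests and inducedness from the problem. Both are recovered by minimizing the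
number of edges, because the two shortening operations preserve the separation of `u` and `v`. -/
theorem hasForestAvoiding_iff {G : SimpleGraph V} {f : V → Fin 2} {u v : V} (huv : G.Adj u v) :
    HasForestAvoiding G f s(u, v) ↔ Separable G (residue f) u v := by
  constructor
  · rintro ⟨H, hH, he⟩
    refine ⟨H, hH.le, fun x => (degParity_eq_iff H x (f x)).2 (hH.parity x), fun hr => he ?_⟩
    have h := hH.induced (H.connectedComponentMk u)
    have h' : (G.induce (H.connectedComponentMk u).supp).Adj ⟨u, rfl⟩
        ⟨v, SimpleGraph.ConnectedComponent.sound hr.symm⟩ := huv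
    rw [← h] at h'
    exact h'
  · rintro ⟨J₀, h₀⟩
    obtain ⟨J, ⟨hJG, hJd, hJr⟩, hmin⟩ := Set.exists_min_image
      {J : SimpleGraph V | J ≤ G ∧ (∀ x, degParity J x = residue f x) ∧ ¬ J.Reachable u v}
      (fun J => J.edgeSet.ncard) (Set.toFinite _) ⟨J₀, h₀⟩
    refine ⟨J, ⟨⟨hJG, ?_, ?_⟩, fun x => (degParity_eq_iff J x (f x)).1 (hJd x)⟩,
      fun he => hJr (SimpleGraph.Adj.reachable he)⟩
    · by_contra hcon
      obtain ⟨J', hle, hd, hlt⟩ := exists_shorter_of_not_isAcyclic hcon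
      exact absurd (hmin J' ⟨hle.trans hJG, fun x => (hd x).trans (hJd x),
        fun h => hJr (h.mono hle)⟩) (not_le.2 hlt)
    · intro T
      ext ⟨a, ha⟩ ⟨b, hb⟩
      refine ⟨fun h => hJG h, fun h => ?_⟩
      by_contra hab
      have hr : J.Reachable a b := SimpleGraph.ConnectedComponent.exact
        ((show J.connectedComponentMk a = T from ha).trans
          (show J.connectedComponentMk b = T from hb).symm)
      obtain ⟨J', hle, hd, hr', hlt⟩ := exists_shorter hJG (show G.Adj a b from h) hab hr
      exact absurd (hmin J' ⟨hle, fun x => (hd x).trans (hJd x),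
        fun h => hJr (reachable_of_adj_reachable id hr' h)⟩) (not_le.2 hlt)

end Parity

/-! ### Connectivity inside vertex sets -/

section Within

variable {V : Type*}

/-- The subgraph of `G` on the same vertices whose edges are those inside `A`. -/
def within (G : SimpleGraph V) (A : Set V) : SimpleGraph V where
  Adj a b := G.Adj a b ∧ a ∈ A ∧ b ∈ A
  symm := ⟨fun _ _ h => ⟨h.1.symm, h.2.2, h.2.1⟩⟩
  loopless := ⟨fun _ h => h.1.ne rfl⟩

theorem within_le (G : SimpleGraph V) (A : Set V) : within G A ≤ G := fun _ _ h => h.1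

theorem within_mono (G : SimpleGraph V) {A B : Set V} (h : A ⊆ B) : within G A ≤ within G B :=
  fun _ _ hab => ⟨hab.1, h hab.2.1, h hab.2.2⟩

/-- Any two vertices of `A` are connected inside `A`. -/
def ConnectedOn (G : SimpleGraph V) (A : Set V) : Prop :=
  ∀ a ∈ A, ∀ b ∈ A, (within G A).Reachable a b

theorem mem_of_reachable {H : SimpleGraph V} {A : Set V}
    (hA : ∀ a ∈ A, ∀ b, H.Adj a b → b ∈ A) {a b : V} (h : H.Reachable a b) (ha : a ∈ A) :
    b ∈ A := by
  obtain ⟨p⟩ := h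
  induction p with
  | nil => exact ha
  | cons hadj _ ih => exact ih (hA _ ha _ hadj)

theorem exists_adj_of_reachable {H : SimpleGraph V} {A : Set V} {a b : V} (h : H.Reachable a b)
    (ha : a ∈ A) (hb : b ∉ A) : ∃ c ∈ A, ∃ d ∉ A, H.Adj c d := by
  by_contra! hcon
  exact hb (mem_of_reachable (fun c hc d hcd => by_contra fun hd => hcon c hc d hd hcd) h ha)

theorem mem_of_reachable_within {G : SimpleGraph V} {A : Set V} {a b : V}
    (h : (within G A).Reachable a b) (ha : a ∈ A) : b ∈ A :=
  mem_of_reachable (H := within G A) (fun _ _ _ hcd => hcd.2.2) h ha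

theorem reachable_within_component {G : SimpleGraph V} {A : Set V} {a b : V}
    (h : (within G A).Reachable a b) :
    (within G {c | (within G A).Reachable a c}).Reachable a b := by
  have : ∀ c, (within G A).Reachable a c →
      (within G {c | (within G A).Reachable a c}).Reachable a c := by
    intro c hc
    -- The invariant also records reachability inside the component, so each step of the walk is
    -- seen to stay there.
    have key := mem_of_reachable (H := within G A)
      (A := {c | (within G A).Reachable a c ∧
        (within G {c | (within G A).Reachable a c}).Reachable a c}) ?_ hc
      ⟨SimpleGraph.Reachable.refl _, SimpleGraph.Reachable.refl _⟩
    · exact key.2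
    · rintro p ⟨hp, hp'⟩ q hpq
      have hq := hp.trans hpq.reachable
      exact ⟨hq, hp'.trans (SimpleGraph.Adj.reachable ⟨hpq.1, hp, hq⟩)⟩
  exact this b h

theorem connectedOn_of_center {G : SimpleGraph V} {A : Set V} (c : V)
    (h : ∀ a ∈ A, (within G A).Reachable c a) : ConnectedOn G A :=
  fun a ha b hb => (h a ha).symm.trans (h b hb)

theorem connectedOn_singleton (G : SimpleGraph V) (u : V) : ConnectedOn G {u} := by
  rintro a rfl b rfl
  exact SimpleGraph.Reachable.refl _

theorem reachable_induce_iff {G : SimpleGraph V} {A : Set V} (a b : A) :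
    (G.induce A).Reachable a b ↔ (within G A).Reachable a b := by
  constructor
  · exact reachable_of_adj_reachable (K' := within G A) Subtype.val
      fun a b h => SimpleGraph.Adj.reachable ⟨h, a.2, b.2⟩
  · intro h
    -- The default `a` for vertices outside `A` is immaterial: every edge of `within G A` has both
    -- ends in `A`.
    have := reachable_of_adj_reachable (K' := G.induce A)
      (fun c => if hc : c ∈ A then (⟨c, hc⟩ : A) else a) ?_ h
    · simpa using this
    · rintro c d ⟨hcd, hc, hd⟩
      simp only [hc, hd, dif_pos]
      exact SimpleGraph.Adj.reachable hcd

theorem induce_connected_iff {G : SimpleGraph V} {A : Set V} :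
    (G.induce A).Connected ↔ A.Nonempty ∧ ConnectedOn G A := by
  rw [SimpleGraph.connected_iff]
  constructor
  · rintro ⟨h, ⟨a⟩⟩
    exact ⟨⟨a, a.2⟩, fun p hp q hq => (reachable_induce_iff ⟨p, hp⟩ ⟨q, hq⟩).1 (h _ _)⟩
  · rintro ⟨⟨a, ha⟩, h⟩
    exact ⟨fun p q => (reachable_induce_iff p q).2 (h _ p.2 _ q.2), ⟨⟨a, ha⟩⟩⟩

variable [Finite V]

/-- In a graph without cut-vertices a connected set with connected complement can be enlarged by
one vertex so that both remain connected. -/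
theorem exists_connectedOn_insert {G : SimpleGraph V} (hG : ∀ y, ConnectedOn G {y}ᶜ)
    {A : Set V} {u v b : V} (hu : u ∈ A) (hv : v ∉ A) (hA : ConnectedOn G A)
    (hA' : ConnectedOn G Aᶜ) (hb : b ∉ A) (hbv : b ≠ v) :
    ∃ w ∉ A, w ≠ v ∧ ConnectedOn G (insert w A) ∧ ConnectedOn G (insert w A)ᶜ := by
  have huv : u ≠ v := by rintro rfl; exact hv hu
  have hne : ({w | w ∉ A ∧ w ≠ v ∧ ∃ a ∈ A, G.Adj a w} : Set V).Nonempty := by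
    obtain ⟨c, hc, d, hd, hcd⟩ := exists_adj_of_reachable (hG v u huv b hbv) hu hb
    exact ⟨d, hd, hcd.2.2, c, hc, hcd.1⟩
  -- Among the neighbours of `A` other than `v`, choose the one whose removal from the complement
  -- leaves `v` the largest component. Maximality will show that nothing else is left.
  obtain ⟨w, ⟨hwA, hwv, a, haA, haw⟩, hmax⟩ := Set.exists_max_image
    {w | w ∉ A ∧ w ≠ v ∧ ∃ a ∈ A, G.Adj a w}
    (fun w => {z | (within G (Aᶜ \ {w})).Reachable v z}.ncard) (Set.toFinite _) hne
  have hvw : v ∈ Aᶜ \ {w} := ⟨hv, hwv.symm⟩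
  have hcompl : (insert w A)ᶜ = Aᶜ \ {w} := by
    ext z
    simp only [Set.mem_compl_iff, Set.mem_insert_iff, Set.mem_sdiff, Set.mem_singleton_iff]
    tauto
  refine ⟨w, hwA, hwv, ?_, ?_⟩
  · refine connectedOn_of_center a ?_
    rintro z (rfl | hz)
    · exact SimpleGraph.Adj.reachable ⟨haw, Or.inr haA, Or.inl rfl⟩
    · exact (hA a haA z hz).mono (within_mono G (Set.subset_insert _ _))
  rw [hcompl]
  refine connectedOn_of_center v ?_
  by_contra! hcon
  obtain ⟨z, hz, hvz⟩ := hcon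
  have hwu : u ≠ w := by rintro rfl; exact hwA hu
  -- A component of the remainder without `v` must touch `A`, since `w` alone does not separate it
  -- from `u`. Its contact vertex `c` is a competitor of `w`.
  obtain ⟨c, hc, d, hd, hcd⟩ := exists_adj_of_reachable
    (A := {z' | (within G (Aᶜ \ {w})).Reachable z z'}) (hG w z hz.2 u hwu)
    (SimpleGraph.Reachable.refl _) (fun h => (mem_of_reachable_within h hz).1 hu)
  have hcm := mem_of_reachable_within hc hz
  have hdA : d ∈ A := by
    by_contra hdA
    exact hd (SimpleGraph.Reachable.trans hc
      (SimpleGraph.Adj.reachable ⟨hcd.1, hcm, hdA, hcd.2.2⟩))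
  have hcv : ¬ (within G (Aᶜ \ {w})).Reachable v c := fun h =>
    hvz (h.trans (SimpleGraph.Reachable.symm hc))
  have hcne : c ≠ v := by rintro rfl; exact hcv (SimpleGraph.Reachable.refl _)
  refine absurd (hmax c ⟨hcm.1, hcne, d, hdA, hcd.1.symm⟩) (not_le.2 ?_)
  -- Removing `c` instead of `w` leaves the old component of `v` intact, as `c` lies outside it.
  have hsub : ∀ p, (within G (Aᶜ \ {w})).Reachable v p →
      (within G (Aᶜ \ {c})).Reachable v p := by
    intro p hp
    refine (reachable_within_component hp).mono (within_mono G ?_)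
    intro q hq
    refine ⟨(mem_of_reachable_within hq hvw).1, ?_⟩
    rintro rfl
    exact hcv hq
  refine Set.ncard_lt_ncard ?_ (Set.toFinite _)
  refine (Set.ssubset_iff_of_subset hsub).2 ⟨w, ?_, fun h => (mem_of_reachable_within h hvw).2 rfl⟩
  -- The complement of `A` is connected, so the component of `v` has an edge leaving it, and this
  -- edge can only lead to `w`. Hence `w` joins the component once `c` is removed instead, against
  -- maximality.
  obtain ⟨p, hp, q, hq, hpq⟩ := exists_adj_of_reachable
    (A := {z' | (within G (Aᶜ \ {w})).Reachable v z'}) (hA' v hv w hwA)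
    (SimpleGraph.Reachable.refl _) (fun h => (mem_of_reachable_within h hvw).2 rfl)
  have hqw : q = w := by
    by_contra hqw
    exact hq (SimpleGraph.Reachable.trans hp
      (SimpleGraph.Adj.reachable ⟨hpq.1, mem_of_reachable_within hp hvw, hpq.2.2, hqw⟩))
  subst hqw
  refine (hsub p hp).trans (SimpleGraph.Adj.reachable ⟨hpq.1, ⟨hpq.2.1, ?_⟩, hpq.2.2, ?_⟩)
  · rintro rfl
    exact hcv hp
  · rintro rfl
    exact hcm.2 rfl

end Within

/-! ### Graphs without cut-vertices -/

section NoCutVertex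

variable {V : Type*} [Fintype V]

/-- With the edges between the two sides deleted, the sides are the components and both have even
sum, so the prescribed parities are still realizable. -/
theorem separable_of_connectedOn {G : SimpleGraph V} {g : V → ZMod 2} {A : Set V} {u v : V}
    (hA : ConnectedOn G A) (hA' : ConnectedOn G Aᶜ) (hsum : ∑ x, g x = 0)
    (hgA : ∑ x with x ∈ A, g x = 0) (huv : ¬ (u ∈ A ↔ v ∈ A)) : Separable G g u v := by
  have hgA' : ∑ x with x ∉ A, g x = 0 := by
    have := Finset.sum_filter_add_sum_filter_not Finset.univ (fun x => x ∈ A) g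
    rwa [hgA, hsum, zero_add] at this
  have hclosed : ∀ a b, (within G A ⊔ within G Aᶜ).Reachable a b → (a ∈ A ↔ b ∈ A) := by
    intro a b h
    refine mem_of_reachable (A := {c | a ∈ A ↔ c ∈ A}) ?_ h Iff.rfl
    rintro c hc d (hcd | hcd)
    · exact hc.trans (iff_of_true hcd.2.1 hcd.2.2)
    · exact hc.trans (iff_of_false hcd.2.1 hcd.2.2)
  have heven : ComponentsEven (within G A ⊔ within G Aᶜ) g := by
    intro s
    by_cases hs : s ∈ A
    · rw [← hgA]
      congr 1
      ext w
      simp only [Finset.mem_filter, Finset.mem_univ, true_and]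
      exact ⟨fun h => (hclosed _ _ h).1 hs, fun h => (hA s hs w h).mono le_sup_left⟩
    · rw [← hgA']
      congr 1
      ext w
      simp only [Finset.mem_filter, Finset.mem_univ, true_and]
      exact ⟨fun h h' => hs ((hclosed _ _ h).2 h'), fun h => (hA' s hs w h).mono le_sup_right⟩
  obtain ⟨J, hJ, hd⟩ := exists_degParity_eq heven
  exact ⟨J, hJ.trans (sup_le (within_le _ _) (within_le _ _)), hd,
    fun h => huv (hclosed _ _ (h.mono hJ))⟩

theorem eq_one_of_ne_zero {a : ZMod 2} (h : a ≠ 0) : a = 1 := by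
  revert a
  decide

/-- The function with value one at `u` and at `v` only. -/
noncomputable def endpoints (u v x : V) : ZMod 2 := if x = u ∨ x = v then 1 else 0

theorem separable_of_noCutVertex {G : SimpleGraph V} {g : V → ZMod 2} {u v : V} (huv : u ≠ v)
    (hG : ∀ y, ConnectedOn G {y}ᶜ) (hsum : ∑ x, g x = 0) {x : V} (hx : g x ≠ endpoints u v x) :
    Separable G g u v := by
  -- An endpoint of value zero can be split off by itself. Otherwise both endpoints have value one
  -- and `x` is a third vertex of value one.
  by_cases hgu : g u = 0
  · refine separable_of_connectedOn (connectedOn_singleton G u) (hG u) hsum ?_ (by simp [huv.symm])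
    simp [Finset.sum_filter, hgu]
  by_cases hgv : g v = 0
  · refine separable_of_connectedOn (connectedOn_singleton G v) (hG v) hsum ?_ (by simp [huv])
    simp [Finset.sum_filter, hgv]
  have hxu : x ≠ u := by rintro rfl; exact hx (by simp [endpoints, eq_one_of_ne_zero hgu])
  have hxv : x ≠ v := by rintro rfl; exact hx (by simp [endpoints, eq_one_of_ne_zero hgv])
  have hgx : g x ≠ 0 := by simpa [endpoints, hxu, hxv] using hx
  -- A largest admissible side on which `u` is the only vertex of value one. The next vertex must
  -- then have value one, which makes the sum of the enlarged side even.
  obtain ⟨A, ⟨hu, hv, hA, hA', hgA⟩, hmax⟩ := Set.exists_max_image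
    {A : Set V | u ∈ A ∧ v ∉ A ∧ ConnectedOn G A ∧ ConnectedOn G Aᶜ ∧ ∀ a ∈ A, a ≠ u → g a = 0}
    (fun A => A.ncard) (Set.toFinite _)
    ⟨{u}, rfl, huv.symm, connectedOn_singleton G u, hG u, fun a ha hau => absurd ha hau⟩
  obtain ⟨w, hwA, hwv, hB, hB'⟩ := exists_connectedOn_insert hG hu hv hA hA'
    (fun h => hgx (hgA x h hxu)) hxv
  have hgw : g w ≠ 0 := by
    intro hgw
    refine absurd (hmax (insert w A) ⟨Or.inr hu, ?_, hB, hB', ?_⟩) (not_le.2 ?_)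
    · rintro (h | h)
      · exact hwv h.symm
      · exact hv h
    · rintro a (rfl | ha) hau
      · exact hgw
      · exact hgA a ha hau
    · simp only [Set.ncard_insert_of_notMem hwA (Set.toFinite _)]
      omega
  have hwu : u ≠ w := by rintro rfl; exact hwA hu
  refine separable_of_connectedOn hB hB' hsum ?_ (fun h => ?_)
  · rw [← Finset.sum_subset (s₁ := {u, w})]
    · rw [Finset.sum_pair hwu, eq_one_of_ne_zero hgu, eq_one_of_ne_zero hgw]
      decide
    · intro y hy
      simp only [Finset.mem_insert, Finset.mem_singleton] at hy
      rcases hy with rfl | rfl <;> simp [hu]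
    · intro y hy hy'
      simp only [Finset.mem_insert, Finset.mem_singleton, not_or] at hy'
      simp only [Finset.mem_filter, Finset.mem_univ, true_and, Set.mem_insert_iff, hy'.2,
        false_or] at hy
      exact hgA y hy hy'.1
  · rcases h.1 (Or.inr hu) with h | h
    · exact hwv h.symm
    · exact hv h

/-- A component containing `u` but not `v` would have exactly one vertex of odd degree. -/
theorem not_separable_endpoints {G : SimpleGraph V} {g : V → ZMod 2} {u v : V}
    (hg : ∀ x, g x = endpoints u v x) : ¬ Separable G g u v := by
  rintro ⟨J, -, hd, hr⟩
  have h := degParity_sum_eq_zero J (Finset.univ.filter fun w => J.Reachable u w) (by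
    intro c hc d hcd
    simp only [Finset.mem_filter, Finset.mem_univ, true_and] at hc ⊢
    exact hc.trans hcd.reachable)
  rw [Finset.sum_eq_single u] at h
  · simp [hd, hg, endpoints] at h
  · intro b hb hbu
    simp only [Finset.mem_filter, Finset.mem_univ, true_and] at hb
    have hbv : b ≠ v := by rintro rfl; exact hr hb
    simp [hd, hg, endpoints, hbu, hbv]
  · simp

theorem separable_iff_of_noCutVertex {G : SimpleGraph V} {g : V → ZMod 2} {u v : V} (huv : u ≠ v)
    (hG : ∀ y, ConnectedOn G {y}ᶜ) (hsum : ∑ x, g x = 0) :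
    Separable G g u v ↔ ∃ x, g x ≠ endpoints u v x := by
  constructor
  · intro h
    by_contra! hcon
    exact not_separable_endpoints hcon h
  · rintro ⟨x, hx⟩
    exact separable_of_noCutVertex huv hG hsum hx

end NoCutVertex

/-! ### Reduction to a part attached at one vertex -/

section Reduction

variable {V : Type*}

/-- The map that collapses everything outside `S` to `x`. -/
noncomputable def collapse (S : Set V) (x : S) (w : V) : S := if h : w ∈ S then ⟨w, h⟩ else x

theorem collapse_of_mem {S : Set V} (x : S) {w : V} (h : w ∈ S) : collapse S x w = ⟨w, h⟩ :=
  dif_pos h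

theorem collapse_of_notMem {S : Set V} (x : S) {w : V} (h : w ∉ S) : collapse S x w = x :=
  dif_neg h

/-- The part `S` of `G` is joined to the rest of `G` only at `x`. -/
structure AttachedAt (G : SimpleGraph V) (S : Set V) (x : V) : Prop where
  mem : x ∈ S
  not_adj : ∀ a ∈ S, a ≠ x → ∀ b ∉ S, ¬ G.Adj a b

theorem AttachedAt.collapse_adj {G : SimpleGraph V} {S : Set V} {x : V} (h : AttachedAt G S x)
    {a b : V} (hab : G.Adj a b) :
    collapse S ⟨x, h.mem⟩ a = collapse S ⟨x, h.mem⟩ b ∨ (a ∈ S ∧ b ∈ S) := by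
  by_cases ha : a ∈ S <;> by_cases hb : b ∈ S
  · exact Or.inr ⟨ha, hb⟩
  · left
    rw [collapse_of_mem _ ha, collapse_of_notMem _ hb, Subtype.mk.injEq]
    by_contra hax
    exact h.not_adj a ha hax b hb hab
  · left
    rw [collapse_of_mem _ hb, collapse_of_notMem _ ha, Subtype.mk.injEq]
    by_contra hbx
    exact h.not_adj b hb (fun h => hbx h.symm) a ha hab.symm
  · left
    rw [collapse_of_notMem _ ha, collapse_of_notMem _ hb]

variable [Fintype V]

theorem sum_subtype_of_eq_zero {M : Type*} [AddCommMonoid M] {S : Set V} {h : V → M}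
    (h0 : ∀ y ∉ S, h y = 0) : ∑ y, h y = ∑ y : S, h y := by
  rw [← Finset.sum_subset (Finset.subset_univ S.toFinset) fun y _ hy => h0 y (by simpa using hy)]
  exact (Finset.sum_subtype _ (fun y => by simp) h)

/-- Degree parities always sum to zero, so the parity at the attachment vertex need not be computed:
it follows from those at all other vertices. -/
theorem eq_of_eq_off_of_sum {W : Type*} [Fintype W] {g h : W → ZMod 2} {x : W}
    (hgh : ∀ w, w ≠ x → g w = h w) (hsum : ∑ w, g w = ∑ w, h w) (w : W) : g w = h w := by
  by_cases hw : w = x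
  · subst hw
    rw [← Finset.add_sum_erase _ g (Finset.mem_univ w),
      ← Finset.add_sum_erase _ h (Finset.mem_univ w),
      Finset.sum_congr rfl fun y hy => hgh y (Finset.ne_of_mem_erase hy)] at hsum
    exact add_right_cancel hsum
  · exact hgh w hw

/-- Restriction to `S` changes parities only at `x`, where the total sum corrects them. Conversely,
a subgraph of the part is completed by the outer edges of any realization of `g`, and a walk through
those edges leaves and re-enters `S` only at `x`. -/
theorem AttachedAt.separable_iff {G : SimpleGraph V} {S : Set V} {x : V} (h : AttachedAt G S x)
    {g : V → ZMod 2} {g' : S → ZMod 2} (hg : ComponentsEven G g)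
    (hgg' : ∀ w : S, (w : V) ≠ x → g' w = g w) (hg' : ∑ w, g' w = 0) (u v : S) :
    Separable G g u v ↔ Separable (G.induce S) g' u v := by
  constructor
  · rintro ⟨J, hJ, hd, hr⟩
    refine ⟨J.induce S, fun a b hab => hJ hab, ?_, fun hcon => hr ?_⟩
    · refine eq_of_eq_off_of_sum (x := ⟨x, h.mem⟩) ?_ (by rw [degParity_sum_univ, hg'])
      rintro w hw
      have hwx : (w : V) ≠ x := fun h => hw (Subtype.ext h)
      rw [hgg' w hwx, ← hd, degParity, degParity, sum_subtype_of_eq_zero (S := S)]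
      · rfl
      · intro y hy
        exact if_neg fun hwy => h.not_adj w w.2 hwx y hy (hJ hwy)
    · exact reachable_of_adj_reachable Subtype.val (fun a b hab => SimpleGraph.Adj.reachable hab)
        hcon
  · rintro ⟨J', hJ', hd, hr⟩
    obtain ⟨J₀, hJ₀, hd₀⟩ := exists_degParity_eq hg
    let J : SimpleGraph V :=
      { Adj := fun a b => (∃ ha : a ∈ S, ∃ hb : b ∈ S, J'.Adj ⟨a, ha⟩ ⟨b, hb⟩) ∨
          (J₀.Adj a b ∧ ¬ (a ∈ S ∧ b ∈ S))
        symm := ⟨by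
          rintro a b (⟨ha, hb, hab⟩ | ⟨hab, hn⟩)
          · exact Or.inl ⟨hb, ha, hab.symm⟩
          · exact Or.inr ⟨hab.symm, fun h => hn h.symm⟩⟩
        loopless := ⟨by
          rintro a (⟨ha, hb, hab⟩ | ⟨hab, hn⟩)
          · exact hab.ne rfl
          · exact hab.ne rfl⟩ }
    have hJ : ∀ a b, J.Adj a b ↔ (∃ ha : a ∈ S, ∃ hb : b ∈ S, J'.Adj ⟨a, ha⟩ ⟨b, hb⟩) ∨
        (J₀.Adj a b ∧ ¬ (a ∈ S ∧ b ∈ S)) := fun _ _ => Iff.rfl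
    clear_value J
    have hJG : J ≤ G := by
      intro a b h
      rcases (hJ a b).1 h with (⟨ha, hb, hab⟩ | ⟨hab, hn⟩)
      · exact hJ' hab
      · exact hJ₀ hab
    refine ⟨J, hJG, ?_, fun hcon => hr ?_⟩
    · refine eq_of_eq_off_of_sum (x := x) ?_
        (by rw [degParity_sum_univ, sum_eq_zero_of_componentsEven hg])
      intro w hwx
      by_cases hw : w ∈ S
      · rw [← hgg' ⟨w, hw⟩ hwx, ← hd, degParity, degParity, sum_subtype_of_eq_zero (S := S)]
        · refine Finset.sum_congr rfl fun y _ => if_congr ((hJ _ _).trans ?_) rfl rfl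
          constructor
          · rintro (⟨_, _, hab⟩ | ⟨_, hn⟩)
            · exact hab
            · exact absurd ⟨hw, y.2⟩ hn
          · exact fun hab => Or.inl ⟨hw, y.2, hab⟩
        · intro y hy
          exact if_neg fun hwy => h.not_adj w hw hwx y hy (hJG hwy)
      · rw [← hd₀, degParity, degParity]
        refine Finset.sum_congr rfl fun y _ => if_congr ((hJ _ _).trans ?_) rfl rfl
        constructor
        · rintro (⟨ha, _, _⟩ | ⟨hab, _⟩)
          · exact absurd ha hw
          · exact hab
        · exact fun hab => Or.inr ⟨hab, fun h => hw h.1⟩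
    -- Collapsing the outside to `x` turns a walk of the glued graph into a connection in `J'`.
    · have := reachable_of_adj_reachable (K' := J') (collapse S ⟨x, h.mem⟩) ?_ hcon
      · simpa [collapse_of_mem] using this
      · intro a b hab
        rcases h.collapse_adj (hJG hab) with heq | ⟨ha, hb⟩
        · rw [heq]
        · rw [collapse_of_mem _ ha, collapse_of_mem _ hb]
          rcases (hJ a b).1 hab with ⟨_, _, hab⟩ | ⟨_, hn⟩
          · exact hab.reachable
          · exact absurd ⟨ha, hb⟩ hn

end Reduction

/-! ### A criterion in terms of the components of `G - y` containing an end of the edge -/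

section Criterion

variable {V : Type*}

/-- `w` lies in a component of `G - y` that contains one of `u` and `v`. -/
def Far (G : SimpleGraph V) (u v y w : V) : Prop :=
  ∃ a, (a = u ∨ a = v) ∧ a ≠ y ∧ (within G {y}ᶜ).Reachable a w

theorem Far.ne {G : SimpleGraph V} {u v y w : V} (h : Far G u v y w) : w ≠ y := by
  obtain ⟨a, -, ha, h⟩ := h
  exact mem_of_reachable_within h ha

theorem Far.of_adj {G : SimpleGraph V} {u v y w z : V} (h : Far G u v y w)
    (hwz : G.Adj w z) (hz : z ≠ y) : Far G u v y z := by
  have hw := h.ne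
  obtain ⟨a, ha, hay, h⟩ := h
  exact ⟨a, ha, hay, h.trans (SimpleGraph.Adj.reachable ⟨hwz, hw, hz⟩)⟩

section Transfer

variable {G : SimpleGraph V} {S : Set V} {x : V}

theorem AttachedAt.reachable_within_iff (h : AttachedAt G S x) (y a w : S) :
    (within G {(y : V)}ᶜ).Reachable a w ↔ (within (G.induce S) {y}ᶜ).Reachable a w := by
  constructor
  · intro hr
    have := reachable_of_adj_reachable (K' := within (G.induce S) {y}ᶜ)
      (collapse S ⟨x, h.mem⟩) ?_ hr
    · simpa [collapse_of_mem] using this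
    · intro p q hpq
      rcases h.collapse_adj hpq.1 with heq | ⟨hp, hq⟩
      · rw [heq]
      · rw [collapse_of_mem _ hp, collapse_of_mem _ hq]
        exact SimpleGraph.Adj.reachable ⟨hpq.1, fun h => hpq.2.1 (congrArg Subtype.val h),
          fun h => hpq.2.2 (congrArg Subtype.val h)⟩
  · refine reachable_of_adj_reachable (K' := within G {(y : V)}ᶜ) Subtype.val fun p q hpq => ?_
    exact SimpleGraph.Adj.reachable ⟨hpq.1, fun h => hpq.2.1 (Subtype.ext h),
      fun h => hpq.2.2 (Subtype.ext h)⟩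

theorem AttachedAt.far_iff (h : AttachedAt G S x) (u v y w : S) :
    Far G u v y w ↔ Far (G.induce S) u v y w := by
  constructor
  · rintro ⟨a, ha, hay, hr⟩
    have haS : a ∈ S := by rcases ha with rfl | rfl <;> exact Subtype.coe_prop _
    refine ⟨⟨a, haS⟩, ?_, fun h => hay (congrArg Subtype.val h),
      (h.reachable_within_iff y ⟨a, haS⟩ w).1 hr⟩
    rcases ha with rfl | rfl
    · exact Or.inl rfl
    · exact Or.inr rfl
  · rintro ⟨a, ha, hay, hr⟩
    refine ⟨a, ?_, fun h => hay (Subtype.ext h), (h.reachable_within_iff y a w).2 hr⟩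
    rcases ha with rfl | rfl
    · exact Or.inl rfl
    · exact Or.inr rfl

/-- Collapsing everything outside `S` to `x` sends `w` to `x` and respects the deletion of `y`. -/
theorem AttachedAt.far_base (h : AttachedAt G S x) (u v y : S) {w : V} (hw : w ∉ S)
    (hfar : Far G u v y w) : Far G u v y x := by
  obtain ⟨a, ha, hay, hr⟩ := hfar
  have haS : a ∈ S := by rcases ha with rfl | rfl <;> exact Subtype.coe_prop _
  refine ⟨a, ha, hay, ?_⟩
  refine (h.reachable_within_iff y ⟨a, haS⟩ ⟨x, h.mem⟩).2 ?_
  have := reachable_of_adj_reachable (K' := within (G.induce S) {y}ᶜ)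
    (collapse S ⟨x, h.mem⟩) ?_ hr
  · simpa [collapse_of_mem, haS, collapse_of_notMem _ hw] using this
  · intro p q hpq
    rcases h.collapse_adj hpq.1 with heq | ⟨hp, hq⟩
    · rw [heq]
    · rw [collapse_of_mem _ hp, collapse_of_mem _ hq]
      exact SimpleGraph.Adj.reachable ⟨hpq.1, fun h => hpq.2.1 (congrArg Subtype.val h),
        fun h => hpq.2.2 (congrArg Subtype.val h)⟩

theorem AttachedAt.not_far (h : AttachedAt G S x) (u v : S) {w : V} (hw : w ∉ S) :
    ¬ Far G u v x w := fun hfar => (h.far_base u v ⟨x, h.mem⟩ hw hfar).ne rfl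

end Transfer

/-- The part of `G` made of `y` and the components of `G - y` that contain `u` or `v`. -/
def farPart (G : SimpleGraph V) (u v y : V) : Set V := insert y {w | Far G u v y w}

theorem attachedAt_farPart (G : SimpleGraph V) (u v y : V) : AttachedAt G (farPart G u v y) y where
  mem := Or.inl rfl
  not_adj := by
    rintro a (rfl | ha) hay b hb hab
    · exact hay rfl
    · exact hb (Or.inr (ha.of_adj hab fun h => hb (Or.inl h)))

theorem mem_farPart_left (G : SimpleGraph V) (u v y : V) : u ∈ farPart G u v y := by
  by_cases h : u = y
  · exact Or.inl h
  · exact Or.inr ⟨u, Or.inl rfl, h, SimpleGraph.Reachable.refl _⟩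

theorem mem_farPart_right (G : SimpleGraph V) (u v y : V) : v ∈ farPart G u v y := by
  by_cases h : v = y
  · exact Or.inl h
  · exact Or.inr ⟨v, Or.inr rfl, h, SimpleGraph.Reachable.refl _⟩

/-- The endpoints are adjacent, so those that survive the deletion of `y` lie in one component. -/
theorem far_iff_reachable {G : SimpleGraph V} {u v y a : V} (huv : G.Adj u v)
    (ha : a = u ∨ a = v) (hay : a ≠ y) (w : V) :
    Far G u v y w ↔ (within G {y}ᶜ).Reachable a w := by
  refine ⟨?_, fun h => ⟨a, ha, hay, h⟩⟩
  rintro ⟨b, hb, hby, h⟩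
  by_cases hab : a = b
  · rwa [hab]
  · refine SimpleGraph.Reachable.trans (SimpleGraph.Adj.reachable ⟨?_, hay, hby⟩) h
    rcases ha with rfl | rfl <;> rcases hb with rfl | rfl
    · exact absurd rfl hab
    · exact huv
    · exact huv.symm
    · exact absurd rfl hab

theorem exists_endpoint_ne {u v : V} (huv : u ≠ v) (y : V) : ∃ a, (a = u ∨ a = v) ∧ a ≠ y := by
  by_cases h : u = y
  · exact ⟨v, Or.inr rfl, fun h' => huv (h.trans h'.symm)⟩
  · exact ⟨u, Or.inl rfl, h⟩

theorem connectedOn_farPart {G : SimpleGraph V} (hG : G.Connected) {u v : V} (huv : G.Adj u v)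
    (y : V) : ConnectedOn G (farPart G u v y) := by
  obtain ⟨a, ha, hay⟩ := exists_endpoint_ne huv.ne y
  have hfar := far_iff_reachable huv ha hay
  have key : ∀ w, Far G u v y w → (within G (farPart G u v y)).Reachable a w := by
    intro w hw
    refine (reachable_within_component ((hfar w).1 hw)).mono (within_mono G fun p hp => ?_)
    exact Or.inr ((hfar p).2 hp)
  refine connectedOn_of_center a ?_
  rintro w (rfl | hw)
  · obtain ⟨p, hp, q, hq, hpq⟩ := exists_adj_of_reachable (A := {p | Far G u v w p})
      (hG.preconnected a w) ((hfar a).2 (SimpleGraph.Reachable.refl _)) (fun h => h.ne rfl)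
    have hqw : q = w := by
      by_contra hqw
      exact hq (hp.of_adj hpq hqw)
    subst hqw
    exact (key p hp).trans (SimpleGraph.Adj.reachable ⟨hpq, Or.inr hp, Or.inl rfl⟩)
  · exact key w hw

variable [Fintype V]

/-- The sum of `g` over the vertices outside the components of `G - y` that contain `u` or `v`. -/
noncomputable def nearSum (G : SimpleGraph V) (g : V → ZMod 2) (u v y : V) : ZMod 2 :=
  ∑ w with ¬ Far G u v y w, g w

/-- No vertex separates `x` from both `u` and `v`, and the sum of `g` over the vertices behind `x`
is not the one forced by the edge `uv`. -/
def Criterion (G : SimpleGraph V) (g : V → ZMod 2) (u v : V) : Prop :=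
  ∃ x, (∀ y, y ≠ x → Far G u v y x) ∧ nearSum G g u v x ≠ endpoints u v x

section Transfer

variable {G : SimpleGraph V} {S : Set V} {x : V}

theorem AttachedAt.sum_add (h : AttachedAt G S x) {g : V → ZMod 2} {g' : S → ZMod 2}
    (hsum : ∑ w, g w = 0) (hgg' : ∀ w : S, (w : V) ≠ x → g' w = g w) (hg' : ∑ w, g' w = 0) :
    g' ⟨x, h.mem⟩ = g x + ∑ w with w ∉ S, g w := by
  have h₁ := Finset.sum_filter_add_sum_filter_not Finset.univ (fun w => w ∈ S) g
  rw [hsum, Finset.sum_filter, sum_subtype_of_eq_zero (S := S) (fun y hy => if_neg hy)] at h₁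
  simp only [Subtype.coe_prop, if_true] at h₁
  rw [← Finset.add_sum_erase _ _ (Finset.mem_univ (⟨x, h.mem⟩ : S))] at h₁ hg'
  rw [Finset.sum_congr rfl fun w hw => hgg' w fun h => Finset.ne_of_mem_erase hw (Subtype.ext h)]
    at hg'
  revert h₁ hg'
  generalize (∑ w ∈ Finset.univ.erase (⟨x, h.mem⟩ : S), g w) = a
  generalize g' _ = b
  generalize (∑ w with w ∉ S, g w) = c
  generalize g x = d
  revert a b c d
  decide

/-- The outside enters the sum either as a whole, exactly when `x` does, or with contribution zero.
The first case is accounted for by the corrected value of `g'` at `x`. -/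
theorem AttachedAt.nearSum_eq (h : AttachedAt G S x) {g : V → ZMod 2} {g' : S → ZMod 2}
    (hg : ComponentsEven G g) (hgg' : ∀ w : S, (w : V) ≠ x → g' w = g w) (hg' : ∑ w, g' w = 0)
    (u v y : S) : nearSum G g u v y = nearSum (G.induce S) g' u v y := by
  have hx := h.sum_add (sum_eq_zero_of_componentsEven hg) hgg' hg'
  have h₁ : nearSum G g u v y = (∑ w : S, if ¬ Far G u v y w then g w else 0) +
      ∑ w with w ∉ S, if ¬ Far G u v y w then g w else 0 := by
    rw [nearSum, Finset.sum_filter,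
      ← Finset.sum_filter_add_sum_filter_not Finset.univ (fun w => w ∈ S),
      Finset.sum_filter, sum_subtype_of_eq_zero (S := S) (fun y hy => if_neg hy)]
    simp only [Subtype.coe_prop, if_true]
  -- Inside `S` the two sums differ only in the term at `x`.
  have h₂ : (∑ w : S, if ¬ Far G u v y w then g w else 0) + g' ⟨x, h.mem⟩ *
      (if ¬ Far G u v y x then 1 else 0) = nearSum (G.induce S) g' u v y +
        g x * (if ¬ Far G u v y x then 1 else 0) := by
    rw [nearSum, Finset.sum_filter,
      ← Finset.add_sum_erase _ _ (Finset.mem_univ (⟨x, h.mem⟩ : S)),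
      ← Finset.add_sum_erase (a := (⟨x, h.mem⟩ : S)) _
        (fun w : S => if ¬ Far (G.induce S) u v y w then g' w else 0) (Finset.mem_univ _),
      Finset.sum_congr rfl (g := fun w : S => if ¬ Far (G.induce S) u v y w then g' w else 0)]
    · rw [← h.far_iff u v y ⟨x, h.mem⟩]
      split_ifs <;> ring
    · intro w hw
      rw [hgg' w fun h => Finset.ne_of_mem_erase hw (Subtype.ext h), h.far_iff]
  -- If `x` is far from `y`, the outer vertices still counted form a union of components of `G` and
  -- have even sum. If `x` is not far, no outer vertex is far either.
  have h₃ : (∑ w with w ∉ S, if ¬ Far G u v y w then g w else 0) =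
      (∑ w with w ∉ S, g w) * (if ¬ Far G u v y x then 1 else 0) := by
    by_cases hf : Far G u v y x
    · rw [if_neg (not_not.2 hf), mul_zero, ← Finset.sum_filter, Finset.filter_filter]
      obtain ⟨J, hJ, hd⟩ := exists_degParity_eq hg
      rw [Finset.sum_congr rfl fun w _ => (hd w).symm]
      refine degParity_sum_eq_zero J _ ?_
      intro a ha b hab
      simp only [Finset.mem_filter, Finset.mem_univ, true_and] at ha ⊢
      have hay : a ≠ y := by rintro rfl; exact ha.1 y.2
      have hbS : b ∉ S := by
        intro hb
        by_cases hbx : b = x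
        · subst hbx
          exact ha.2 (hf.of_adj (hJ hab).symm hay)
        · exact h.not_adj b hb hbx a ha.1 (hJ hab).symm
      exact ⟨hbS, fun hb => ha.2 (hb.of_adj (hJ hab).symm hay)⟩
    · rw [if_pos hf, mul_one]
      refine Finset.sum_congr rfl fun w hw => if_pos fun hw' => hf ?_
      exact h.far_base u v y (by simpa using hw) hw'
  rw [h₁, h₃]
  rw [hx] at h₂
  revert h₂
  split_ifs
  all_goals
    generalize (∑ w : S, if ¬ Far G u v y w then g w else 0) = a
    generalize nearSum (G.induce S) g' u v y = b
    generalize (∑ w with w ∉ S, g w) = c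
    generalize g x = d
    revert a b c d
    decide

theorem AttachedAt.criterion_iff (h : AttachedAt G S x) (hS : ConnectedOn G S)
    {g : V → ZMod 2} {g' : S → ZMod 2}
    (hg : ComponentsEven G g) (hgg' : ∀ w : S, (w : V) ≠ x → g' w = g w) (hg' : ∑ w, g' w = 0)
    (u v : S) : Criterion G g u v ↔ Criterion (G.induce S) g' u v := by
  have hend : ∀ z : S, endpoints (u : V) v z = endpoints u v z := fun z => by
    simp [endpoints, Subtype.ext_iff]
  constructor
  · rintro ⟨z, hz, hne⟩
    -- A vertex outside `S` is separated from both endpoints by `x`.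
    have hzS : z ∈ S := by
      by_contra hzS
      exact h.not_far u v hzS (hz x fun h' => hzS (h' ▸ h.mem))
    refine ⟨⟨z, hzS⟩, fun y hy => ?_, ?_⟩
    · exact (h.far_iff u v y ⟨z, hzS⟩).1 (hz y fun h => hy (Subtype.ext h))
    · rw [← h.nearSum_eq hg hgg' hg', ← hend]
      exact hne
  · rintro ⟨z, hz, hne⟩
    refine ⟨z, fun y hy => ?_, ?_⟩
    · by_cases hyS : y ∈ S
      · exact (h.far_iff u v ⟨y, hyS⟩ z).2 (hz _ fun h => hy (congrArg Subtype.val h))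
      -- A vertex `y` outside `S` separates nothing inside it, because `S` is connected.
      · refine ⟨u, Or.inl rfl, fun h => hyS (h ▸ u.2), ?_⟩
        refine (hS u u.2 z z.2).mono (within_mono G fun p hp => ?_)
        rintro rfl
        exact hyS hp
    · rw [hend, h.nearSum_eq hg hgg' hg']
      exact hne

end Transfer

/-- Give `x` the value that makes the restriction of `g` to `S` have sum zero. -/
noncomputable def balance (S : Set V) (g : V → ZMod 2) (x : V) (w : S) : ZMod 2 :=
  if (w : V) = x then g x + ∑ z : S, g z else g w

theorem balance_of_ne {S : Set V} {g : V → ZMod 2} {x : V} {w : S} (hw : (w : V) ≠ x) :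
    balance S g x w = g w := if_neg hw

theorem sum_balance {S : Set V} {g : V → ZMod 2} {x : V} (hx : x ∈ S) :
    ∑ w, balance S g x w = 0 := by
  have h₁ := Finset.add_sum_erase Finset.univ (fun w : S => g w) (Finset.mem_univ ⟨x, hx⟩)
  rw [← Finset.add_sum_erase _ _ (Finset.mem_univ (⟨x, hx⟩ : S)),
    Finset.sum_congr rfl (g := fun w : S => g w) fun w hw => balance_of_ne fun h =>
      Finset.ne_of_mem_erase hw (Subtype.ext h), balance, if_pos rfl, ← h₁]
  generalize (∑ w ∈ Finset.univ.erase (⟨x, hx⟩ : S), g w) = a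
  simp only
  generalize g x = d
  revert a d
  decide

theorem criterion_iff_of_noCutVertex {G : SimpleGraph V} {u v : V} (huv : G.Adj u v)
    (hG : ∀ y, ConnectedOn G {y}ᶜ) (g : V → ZMod 2) :
    Criterion G g u v ↔ ∃ x, g x ≠ endpoints u v x := by
  have hfar : ∀ y w, Far G u v y w ↔ w ≠ y := by
    intro y w
    obtain ⟨a, ha, hay⟩ := exists_endpoint_ne huv.ne y
    exact ⟨Far.ne, fun h => ⟨a, ha, hay, hG y a hay w h⟩⟩
  have hsum : ∀ y, nearSum G g u v y = g y := by
    intro y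
    simp only [nearSum, hfar, not_not, Finset.sum_filter]
    simp
  refine exists_congr fun x => ?_
  rw [hsum]
  exact and_iff_right fun y hy => (hfar y x).2 hy.symm

end Criterion

/-- Both sides survive passing to a connected part attached at one vertex, so any proper such part
allows induction. What remains is a connected graph without cut-vertices, where both sides say that
`g` differs from `endpoints`. -/
theorem separable_iff_criterion_aux (k : ℕ) : ∀ {V : Type*} [Fintype V], Fintype.card V ≤ k →
    ∀ (G : SimpleGraph V) (g : V → ZMod 2) (u v : V), G.Adj u v → ComponentsEven G g →
      (Separable G g u v ↔ Criterion G g u v) := by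
  induction k with
  | zero =>
    intro V _ hk G g u
    exact absurd (Fintype.card_pos_iff.2 ⟨u⟩) (by omega)
  | succ k ih =>
    intro V _ hk G g u v huv hg
    have step : ∀ (S : Set V) (x : V), AttachedAt G S x → ConnectedOn G S → u ∈ S → v ∈ S →
        S ≠ Set.univ → (Separable G g u v ↔ Criterion G g u v) := by
      intro S x hS hconn hu hv hne
      have hcard : Fintype.card S ≤ k := by
        have : Fintype.card S < Fintype.card V := by
          obtain ⟨z, hz⟩ := (Set.ne_univ_iff_exists_notMem S).1 hne
          exact Fintype.card_subtype_lt hz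
        omega
      have h₀ := sum_balance (g := g) hS.mem
      have h₁ : ∀ w : S, (w : V) ≠ x → balance S g x w = g w := fun w hw => balance_of_ne hw
      rw [hS.separable_iff hg h₁ h₀ ⟨u, hu⟩ ⟨v, hv⟩,
        hS.criterion_iff hconn hg h₁ h₀ ⟨u, hu⟩ ⟨v, hv⟩]
      exact ih hcard _ _ _ _ huv
        (componentsEven_of_connected (induce_connected_iff.2 ⟨⟨u, hu⟩, hconn⟩) h₀)
    by_cases hG : G.Connected
    · by_cases hcut : ∀ y, ConnectedOn G {y}ᶜ
      · rw [criterion_iff_of_noCutVertex huv hcut,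
          separable_iff_of_noCutVertex huv.ne hcut (sum_eq_zero_of_componentsEven hg)]
      · push Not at hcut
        obtain ⟨y, hy⟩ := hcut
        refine step _ y (attachedAt_farPart G u v y) (connectedOn_farPart hG huv y)
          (mem_farPart_left _ _ _ _) (mem_farPart_right _ _ _ _) fun huniv => hy ?_
        obtain ⟨a, ha, hay⟩ := exists_endpoint_ne huv.ne y
        refine connectedOn_of_center a fun w hw => (far_iff_reachable huv ha hay w).1 ?_
        have : w ∈ farPart G u v y := huniv ▸ Set.mem_univ w
        exact this.resolve_left hw
    -- In a disconnected graph the component of `u` has no edges to the outside, so it is attached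
    -- at any of its vertices.
    · refine step {w | G.Reachable u w} u ⟨SimpleGraph.Reachable.refl _, ?_⟩ ?_
        (SimpleGraph.Reachable.refl _) huv.reachable fun huniv => hG ?_
      · intro a ha _ b hb hab
        exact hb (SimpleGraph.Reachable.trans ha hab.reachable)
      · refine connectedOn_of_center u fun w hw => ?_
        have h : ∀ w, G.Reachable u w ↔ (within G Set.univ).Reachable u w := by
          intro w
          have : within G Set.univ = G := by ext; simp [within]
          rw [this]
        have := reachable_within_component ((h w).1 hw)
        simpa only [← h] using this
      · have h : ∀ w, G.Reachable u w := fun w => by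
          have : w ∈ {w | G.Reachable u w} := huniv ▸ Set.mem_univ w
          exact this
        exact SimpleGraph.connected_iff _ |>.2 ⟨fun a b => (h a).symm.trans (h b), ⟨u⟩⟩

theorem separable_iff_criterion {V : Type*} [Fintype V] {G : SimpleGraph V} {g : V → ZMod 2}
    {u v : V} (huv : G.Adj u v) :
    Separable G g u v ↔ ComponentsEven G g ∧ Criterion G g u v := by
  constructor
  · intro h
    have hg : ComponentsEven G g := by
      obtain ⟨J, hJ, hd, -⟩ := h
      exact componentsEven_of_degParity hJ hd
    exact ⟨hg, (separable_iff_criterion_aux _ le_rfl G g u v huv hg).1 h⟩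
  · rintro ⟨hg, h⟩
    exact (separable_iff_criterion_aux _ le_rfl G g u v huv hg).2 h

/-! ### Cut-vertices -/

section CutVertex

variable {V : Type*}

/-- A connected graph has exactly one component, so the condition is that `G - x` has at most one;
zero components are allowed when `x` is the only vertex. -/
theorem not_isCutVertex_iff [Finite V] {G : SimpleGraph V} (hG : G.Connected) (x : V) :
    ¬ IsCutVertex G x ↔ ConnectedOn G {x}ᶜ := by
  have h₁ : Nat.card G.ConnectedComponent = 1 := by
    rw [Nat.card_eq_one_iff_unique]
    exact ⟨hG.preconnected.subsingleton_connectedComponent, ⟨G.connectedComponentMk x⟩⟩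
  rw [IsCutVertex, h₁, not_lt, Finite.card_le_one_iff_subsingleton]
  constructor
  · intro h a ha b hb
    exact (reachable_induce_iff (⟨a, ha⟩ : ({x}ᶜ : Set V)) ⟨b, hb⟩).1
      (SimpleGraph.ConnectedComponent.exact (Subsingleton.elim _ _))
  · refine fun h => ⟨fun C D => ?_⟩
    induction C using SimpleGraph.ConnectedComponent.ind with | _ a =>
    induction D using SimpleGraph.ConnectedComponent.ind with | _ b =>
    exact SimpleGraph.ConnectedComponent.sound
      ((reachable_induce_iff a b).2 (h a a.2 b b.2))

theorem attachedSet_eq {G : SimpleGraph V} {u v x : V} (huv : G.Adj u v)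
    {C : (G.induce {x}ᶜ).ConnectedComponent} (hC : ∃ w ∈ C.supp, (w : V) ∈ s(u, v)) :
    attachedSet G x C = farPart G u v x := by
  obtain ⟨a, ha, hae⟩ := hC
  rw [attachedSet, farPart]
  congr 1
  ext w
  change _ ↔ Far G u v x w
  rw [far_iff_reachable huv (Sym2.mem_iff.1 hae) a.2]
  constructor
  · rintro ⟨b, hb, rfl⟩
    exact (reachable_induce_iff a b).1 (SimpleGraph.ConnectedComponent.exact
      ((show _ = C from ha).trans (show _ = C from hb).symm))
  · intro h
    refine ⟨⟨w, mem_of_reachable_within h a.2⟩, ?_, rfl⟩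
    exact (SimpleGraph.ConnectedComponent.sound
      ((reachable_induce_iff a ⟨w, mem_of_reachable_within h a.2⟩).2 h)).symm.trans ha

theorem existsUnique_component {G : SimpleGraph V} {u v : V} (x : V) (huv : G.Adj u v) :
    ∃! C : (G.induce {x}ᶜ).ConnectedComponent, ∃ w ∈ C.supp, (w : V) ∈ s(u, v) := by
  obtain ⟨a, ha, hax⟩ := exists_endpoint_ne huv.ne x
  refine ⟨(G.induce {x}ᶜ).connectedComponentMk ⟨a, hax⟩, ⟨⟨a, hax⟩, rfl, Sym2.mem_iff.2 ha⟩, ?_⟩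
  rintro C ⟨b, hb, hbe⟩
  refine (show _ = C from hb).symm.trans (SimpleGraph.ConnectedComponent.sound ?_)
  refine SimpleGraph.Reachable.symm ((reachable_induce_iff ⟨a, hax⟩ b).2 ?_)
  exact (far_iff_reachable huv ha hax b).1
    ⟨b, Sym2.mem_iff.1 hbe, b.2, SimpleGraph.Reachable.refl _⟩

theorem exists_balanced [Fintype V] {S : Set V} {x : V} (hx : x ∈ S) (f : V → Fin 2) :
    ∃ f' : S → Fin 2, (∀ w : S, (w : V) ≠ x → f' w = f w) ∧ IsEvenSum f' := by
  have h : ∀ z : ZMod 2, ∃ c : Fin 2, ((c : ℕ) : ZMod 2) = z := by decide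
  obtain ⟨c, hc⟩ := h (balance S (residue f) x ⟨x, hx⟩)
  refine ⟨fun w => if (w : V) = x then c else f w, fun w hw => if_neg hw, ?_⟩
  rw [isEvenSum_iff, ← sum_balance (g := residue f) hx]
  refine Finset.sum_congr rfl fun w _ => ?_
  by_cases hw : (w : V) = x
  · have : w = ⟨x, hx⟩ := Subtype.ext hw
    subst this
    simp [residue, hc]
  · rw [balance_of_ne hw]
    simp [residue, hw]

theorem cutVertex_reduction [Finite V] {G : SimpleGraph V} {f : V → Fin 2} {u v x : V}
    (hG : G.Connected) (hf : IsEvenSum f) (huv : G.Adj u v) (hx : IsCutVertex G x) :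
    (farPart G u v x).ncard < Nat.card V ∧ (G.induce (farPart G u v x)).Connected ∧
      ∃ e' ∈ (G.induce (farPart G u v x)).edgeSet, e'.map Subtype.val = s(u, v) ∧
        ∃ f' : farPart G u v x → Fin 2,
          (∀ w : farPart G u v x, (w : V) ≠ x → f' w = f w) ∧ IsEvenSum f' ∧
          (HasForestAvoiding G f s(u, v) ↔
            HasForestAvoiding (G.induce (farPart G u v x)) f' e') := by
  have := Fintype.ofFinite V
  have hS := attachedAt_farPart G u v x
  have hu := mem_farPart_left G u v x
  have hv := mem_farPart_right G u v x
  refine ⟨?_, induce_connected_iff.2 ⟨⟨u, hu⟩, connectedOn_farPart hG huv x⟩,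
    s(⟨u, hu⟩, ⟨v, hv⟩), huv, rfl, ?_⟩
  · rw [← Set.ncard_univ]
    refine Set.ncard_lt_ncard (Set.ssubset_univ_iff.2 fun huniv => ?_) (Set.toFinite _)
    refine (not_isCutVertex_iff hG x).2 ?_ hx
    obtain ⟨a, ha, hax⟩ := exists_endpoint_ne huv.ne x
    refine connectedOn_of_center a fun w hw => (far_iff_reachable huv ha hax w).1 ?_
    have : w ∈ farPart G u v x := huniv ▸ Set.mem_univ w
    exact this.resolve_left hw
  · obtain ⟨f', hff', hf'⟩ := exists_balanced hS.mem f
    refine ⟨f', hff', hf', ?_⟩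
    have huv' : (G.induce (farPart G u v x)).Adj ⟨u, hu⟩ ⟨v, hv⟩ := huv
    rw [hasForestAvoiding_iff huv, hasForestAvoiding_iff huv']
    refine hS.separable_iff (componentsEven_of_connected hG ((isEvenSum_iff f).1 hf)) ?_
      ((isEvenSum_iff f').1 hf') ⟨u, hu⟩ ⟨v, hv⟩
    intro w hw
    rw [residue, residue, hff' w hw]

theorem residue_eq_endpoints_iff (f : V → Fin 2) (u v x : V) :
    residue f x = endpoints u v x ↔ (f x = 1 ↔ x ∈ s(u, v)) := by
  rw [residue, endpoints, Sym2.mem_iff]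
  by_cases h : x = u ∨ x = v
  · simp only [h, if_true, iff_true]
    generalize f x = a
    revert a
    decide
  · simp only [h, if_false, iff_false]
    generalize f x = a
    revert a
    decide

theorem noCutVertex_answer [Finite V] {G : SimpleGraph V} {f : V → Fin 2} {u v : V}
    (hG : G.Connected) (hcut : ∀ x, ¬ IsCutVertex G x) (hf : IsEvenSum f) (huv : G.Adj u v) :
    ¬ HasForestAvoiding G f s(u, v) ↔ ∀ z, f z = 1 ↔ z ∈ s(u, v) := by
  have := Fintype.ofFinite V
  rw [hasForestAvoiding_iff huv, separable_iff_of_noCutVertex huv.ne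
    (fun y => (not_isCutVertex_iff hG y).1 (hcut y)) ((isEvenSum_iff f).1 hf)]
  simp only [not_exists, not_not, residue_eq_endpoints_iff]

end CutVertex

theorem cutVertex_part (V : Type*) [Finite V] (G : SimpleGraph V) (f : V → Fin 2) (e : Sym2 V)
    (x : V) (hG : G.Connected) (hf : IsEvenSum f) (he : e ∈ G.edgeSet) (hx : IsCutVertex G x) :
    (∃! C : (G.induce {x}ᶜ).ConnectedComponent, ∃ w ∈ C.supp, (w : V) ∈ e) ∧
      ∀ C : (G.induce {x}ᶜ).ConnectedComponent, (∃ w ∈ C.supp, (w : V) ∈ e) →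
        (attachedSet G x C).ncard < Nat.card V ∧
        (G.induce (attachedSet G x C)).Connected ∧
        ∃ e' ∈ (G.induce (attachedSet G x C)).edgeSet, e'.map Subtype.val = e ∧
        ∃ f' : attachedSet G x C → Fin 2,
          (∀ w : attachedSet G x C, (w : V) ≠ x → f' w = f w) ∧ IsEvenSum f' ∧
          (HasForestAvoiding G f e ↔
            HasForestAvoiding (G.induce (attachedSet G x C)) f' e') := by
  induction e using Sym2.ind with
  | _ u v =>
  refine ⟨existsUnique_component x he, fun C hC => ?_⟩
  rw [attachedSet_eq he hC]
  exact cutVertex_reduction hG hf he hx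

end ParityForest

namespace Ram

/-! ### Polynomial-time computable functions of registers and memory -/

theorem State.reg_setReg (σ : State) (r a i : ℕ) :
    (σ.setReg r a).reg i = if i = r then a else σ.reg i := by
  simp [State.setReg, Function.update_apply]

theorem State.mem_setReg (σ : State) (r a : ℕ) : (σ.setReg r a).mem = σ.mem := rfl

/-- `τ` agrees with `σ` on the memory and on the registers below `k`. -/
structure Frame (k : ℕ) (σ τ : State) : Prop where
  mem : τ.mem = σ.mem
  reg : ∀ i < k, τ.reg i = σ.reg i

theorem Frame.refl (k : ℕ) (σ : State) : Frame k σ σ := ⟨rfl, fun _ _ => rfl⟩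

theorem Frame.trans {k : ℕ} {σ τ υ : State} (h : Frame k σ τ) (h' : Frame k τ υ) :
    Frame k σ υ :=
  ⟨h'.mem.trans h.mem, fun i hi => (h'.reg i hi).trans (h.reg i hi)⟩

theorem Frame.mono {k l : ℕ} {σ τ : State} (h : Frame l σ τ) (hkl : k ≤ l) : Frame k σ τ :=
  ⟨h.mem, fun i hi => h.reg i (hi.trans_le hkl)⟩

theorem Frame.setReg {k r : ℕ} {σ τ : State} (h : Frame k σ τ) (hr : k ≤ r) (a : ℕ) :
    Frame k σ (τ.setReg r a) :=
  ⟨h.mem, fun i hi => by rw [State.reg_setReg, if_neg (by omega), h.reg i hi]⟩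

/-- A context: the values on which a function computed by a program may depend, namely a size,
the memory contents and finitely many variables. -/
structure Ctx (Γ : Type) where
  size : Γ → ℕ
  mem : Γ → ℕ → ℕ
  len : ℕ
  val : ℕ → Γ → ℕ

namespace Ctx

variable {Γ : Type}

/-- The state `σ` holds the values `γ`, with the size in register `0` and the `j`-th variable in
register `pos j`. -/
structure Holds (C : Ctx Γ) (pos : ℕ → ℕ) (γ : Γ) (σ : State) : Prop where
  size : σ.reg 0 = C.size γ
  mem : σ.mem = C.mem γ
  val : ∀ j < C.len, σ.reg (pos j) = C.val j γ

theorem Holds.frame {C : Ctx Γ} {pos : ℕ → ℕ} {γ : Γ} {σ τ : State} (h : C.Holds pos γ σ) {k : ℕ}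
    (hk : 0 < k) (hpos : ∀ j < C.len, pos j < k) (hf : Frame k σ τ) : C.Holds pos γ τ :=
  ⟨(hf.reg 0 hk).trans h.size, hf.mem.trans h.mem,
    fun j hj => (hf.reg _ (hpos j hj)).trans (h.val j hj)⟩

/-- The context extended by two variables. -/
def ext (C : Ctx Γ) : Ctx (Γ × ℕ × ℕ) where
  size γ := C.size γ.1
  mem γ := C.mem γ.1
  len := C.len + 2
  val j γ := if j < C.len then C.val j γ.1 else if j = C.len then γ.2.1 else γ.2.2

/-- Whatever the placement of the variables, `f` is computed by a program that runs in time
polynomial in the size and leaves all registers below a prescribed one unchanged. -/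
def Computes (C : Ctx Γ) (f : Γ → ℕ) : Prop :=
  ∀ (pos : ℕ → ℕ) (k : ℕ), 0 < k → (∀ j < C.len, pos j < k) →
    ∃ (p : Prog) (q : Polynomial ℕ), ∀ γ σ, C.Holds pos γ σ → ∃ (t : ℕ) (τ : State),
      Runs p σ t τ ∧ t ≤ q.eval (C.size γ) ∧ Frame k σ τ ∧ τ.reg k = f γ

variable {C : Ctx Γ} {f g h : Γ → ℕ}

theorem computes_const (a : ℕ) : C.Computes (fun _ => a) := by
  intro pos k _ _
  refine ⟨.const k a, 1, fun γ σ _ => ⟨1, _, .const k a σ, by simp, ?_, ?_⟩⟩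
  · exact (Frame.refl k σ).setReg le_rfl a
  · simp [State.reg_setReg]

theorem computes_size : C.Computes C.size := by
  intro pos k _ _
  refine ⟨.move k 0, 1, fun γ σ hσ => ⟨1, _, .move k 0 σ, by simp, ?_, ?_⟩⟩
  · exact (Frame.refl k σ).setReg le_rfl _
  · simp [State.reg_setReg, hσ.size]

theorem computes_val {j : ℕ} (hj : j < C.len) : C.Computes (C.val j) := by
  intro pos k _ _
  refine ⟨.move k (pos j), 1, fun γ σ hσ => ⟨1, _, .move k (pos j) σ, by simp, ?_, ?_⟩⟩
  · exact (Frame.refl k σ).setReg le_rfl _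
  · simp [State.reg_setReg, hσ.val j hj]

/-- The first result waits in register `k` while the second program works from register `k + 1` on.
This is why `Computes` quantifies over the first free register. -/
theorem computes_binary {op : ℕ → ℕ → ℕ} {instr : ℕ → ℕ → ℕ → Prog}
    (hop : ∀ r s t σ, Runs (instr r s t) σ 1 (σ.setReg r (op (σ.reg s) (σ.reg t))))
    (hf : C.Computes f) (hg : C.Computes g) : C.Computes (fun γ => op (f γ) (g γ)) := by
  intro pos k hk hpos
  obtain ⟨p, q, hp⟩ := hf pos k hk hpos
  obtain ⟨p', q', hp'⟩ := hg pos (k + 1) (by omega) fun j hj => (hpos j hj).trans (by omega)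
  refine ⟨.seq p (.seq p' (instr k k (k + 1))), q + q' + 1, fun γ σ hσ => ?_⟩
  obtain ⟨t, τ, hr, ht, hτ, hv⟩ := hp γ σ hσ
  obtain ⟨t', τ', hr', ht', hτ', hv'⟩ := hp' γ τ (hσ.frame hk hpos hτ)
  refine ⟨_, _, .seq hr (.seq hr' (hop k k (k + 1) τ')), ?_, ?_, ?_⟩
  · simp only [Polynomial.eval_add, Polynomial.eval_one]
    omega
  · exact (hτ.trans (hτ'.mono (by omega))).setReg le_rfl _
  · rw [State.reg_setReg, if_pos rfl, hτ'.reg k (by omega), hv, hv']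

theorem Computes.add (hf : C.Computes f) (hg : C.Computes g) :
    C.Computes (fun γ => f γ + g γ) := computes_binary Runs.add hf hg

theorem Computes.sub (hf : C.Computes f) (hg : C.Computes g) :
    C.Computes (fun γ => f γ - g γ) := computes_binary Runs.sub hf hg

theorem Computes.read (hf : C.Computes f) : C.Computes (fun γ => C.mem γ (f γ)) := by
  intro pos k hk hpos
  obtain ⟨p, q, hp⟩ := hf pos k hk hpos
  refine ⟨.seq p (.load k k), q + 1, fun γ σ hσ => ?_⟩
  obtain ⟨t, τ, hr, ht, hτ, hv⟩ := hp γ σ hσ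
  refine ⟨_, _, .seq hr (.load k k τ), ?_, hτ.setReg le_rfl _, ?_⟩
  · simp only [Polynomial.eval_add, Polynomial.eval_one]
    omega
  · rw [State.reg_setReg, if_pos rfl, hτ.mem, hσ.mem, hv]

theorem Computes.cond (hf : C.Computes f) (hg : C.Computes g) (hh : C.Computes h) :
    C.Computes (fun γ => if f γ = 0 then h γ else g γ) := by
  intro pos k hk hpos
  obtain ⟨p, q, hp⟩ := hf pos k hk hpos
  obtain ⟨p₁, q₁, hp₁⟩ := hg pos k hk hpos
  obtain ⟨p₂, q₂, hp₂⟩ := hh pos k hk hpos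
  refine ⟨.seq p (.cond k p₁ p₂), q + q₁ + q₂ + 1, fun γ σ hσ => ?_⟩
  obtain ⟨t, τ, hr, ht, hτ, hv⟩ := hp γ σ hσ
  simp only [Polynomial.eval_add, Polynomial.eval_one]
  by_cases h0 : f γ = 0
  · obtain ⟨t', τ', hr', ht', hτ', hv'⟩ := hp₂ γ τ (hσ.frame hk hpos hτ)
    refine ⟨_, _, .seq hr (.cond_zero (hv.trans h0) hr'), by omega, hτ.trans hτ', ?_⟩
    rw [hv', if_pos h0]
  · obtain ⟨t', τ', hr', ht', hτ', hv'⟩ := hp₁ γ τ (hσ.frame hk hpos hτ)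
    refine ⟨_, _, .seq hr (.cond_pos (by rwa [hv]) hr'), by omega, hτ.trans hτ', ?_⟩
    rw [hv', if_neg h0]

/-- The same program works: the new variables only occupy further protected registers. -/
theorem Computes.weaken (hf : C.Computes f) : C.ext.Computes (fun γ => f γ.1) := by
  intro pos k hk hpos
  have hpos' : ∀ j < C.len, pos j < k := fun j hj => hpos j (by simp only [ext]; omega)
  obtain ⟨p, q, hp⟩ := hf pos k hk hpos'
  refine ⟨p, q, fun γ σ hσ => hp γ.1 σ ⟨hσ.size, hσ.mem, fun j hj => ?_⟩⟩
  have := hσ.val j (by simp only [ext]; omega)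
  simpa only [ext, hj, if_true] using this

theorem computes_fst : C.ext.Computes (fun γ => γ.2.1) := by
  have h := computes_val (C := C.ext) (j := C.len) (by simp only [ext]; omega)
  simpa [ext] using h

theorem computes_snd : C.ext.Computes (fun γ => γ.2.2) := by
  have h := computes_val (C := C.ext) (j := C.len + 1) (by simp only [ext]; omega)
  simpa [ext] using h

/-- Starting from `a`, apply `s 0`, `s 1`, …, `s (n - 1)`. -/
def fold (n a : ℕ) (s : ℕ → ℕ → ℕ) : ℕ := Nat.rec a s n

theorem fold_zero (a : ℕ) (s : ℕ → ℕ → ℕ) : fold 0 a s = a := rfl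

theorem fold_succ (n a : ℕ) (s : ℕ → ℕ → ℕ) : fold (n + 1) a s = s n (fold n a s) := rfl

/-- Register `k` counts the remaining rounds, `k + 1` the completed ones, `k + 2` holds the
accumulator, and `k + 3` receives the new value and then the constant one. Each round costs the body
plus four instructions and one loop test. -/
theorem runs_fold_loop {pos : ℕ → ℕ} {k : ℕ} (hk : 0 < k) (hpos : ∀ j < C.len, pos j < k)
    {s : Γ → ℕ → ℕ → ℕ} {p : Prog} {q : Polynomial ℕ}
    (hp : ∀ γ σ, C.ext.Holds (fun j => if j < C.len then pos j else
      if j = C.len then k + 1 else k + 2) γ σ → ∃ (t : ℕ) (τ : State), Runs p σ t τ ∧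
        t ≤ q.eval (C.size γ.1) ∧ Frame (k + 3) σ τ ∧ τ.reg (k + 3) = s γ.1 γ.2.1 γ.2.2)
    (γ : Γ) (a m : ℕ) : ∀ (i : ℕ) (σ : State), C.Holds pos γ σ → σ.reg k = m →
      σ.reg (k + 1) = i → σ.reg (k + 2) = fold i a (s γ) → ∃ (t : ℕ) (τ : State),
        Runs (.loop k (.seq p (.seq (.move (k + 2) (k + 3)) (.seq (.const (k + 3) 1)
          (.seq (.add (k + 1) (k + 1) (k + 3)) (.sub k k (k + 3))))))) σ t τ ∧
        t ≤ m * (q.eval (C.size γ) + 5) + 1 ∧ Frame k σ τ ∧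
        τ.reg (k + 2) = fold (i + m) a (s γ) := by
  induction m with
  | zero =>
    intro i σ hσ h₀ h₁ h₂
    exact ⟨1, σ, .loop_zero h₀, by omega, Frame.refl k σ, h₂⟩
  | succ m ih =>
    intro i σ hσ h₀ h₁ h₂
    obtain ⟨t, τ, hr, ht, hτ, hv⟩ := hp (γ, i, fold i a (s γ)) σ (by
      refine ⟨hσ.size, hσ.mem, fun j hj => ?_⟩
      simp only [ext] at hj ⊢
      by_cases hj₁ : j < C.len
      · simp only [hj₁, if_true]
        exact hσ.val j hj₁
      · by_cases hj₂ : j = C.len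
        · simp only [hj₂, lt_irrefl, if_false, if_true, h₁]
        · simp only [hj₁, hj₂, if_false, h₂])
    have hbody := Runs.seq hr (.seq (.move (k + 2) (k + 3) τ) (.seq (.const (k + 3) 1 _)
      (.seq (.add (k + 1) (k + 1) (k + 3) _) (.sub k k (k + 3) _))))
    generalize hυ : State.setReg _ k _ = υ at hbody
    have hυreg : ∀ j, υ.reg j = if j = k then m else if j = k + 1 then i + 1 else
        if j = k + 3 then 1 else if j = k + 2 then fold (i + 1) a (s γ) else τ.reg j := by
      intro j
      have e₀ := (hτ.reg k (by omega)).trans h₀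
      have e₁ := (hτ.reg (k + 1) (by omega)).trans h₁
      rw [← hυ]
      simp only [State.reg_setReg]
      split_ifs <;> first | omega | simp_all [fold_succ]
    have hf : Frame k σ υ := by
      refine ⟨?_, fun j hj => ?_⟩
      · rw [← hυ]
        exact hτ.mem
      · rw [hυreg, if_neg (by omega), if_neg (by omega), if_neg (by omega), if_neg (by omega),
          hτ.reg j (by omega)]
    obtain ⟨t', τ', hr', ht', hτ', hv'⟩ := ih (i + 1) υ (hσ.frame hk hpos hf)
      (by rw [hυreg, if_pos rfl]) (by rw [hυreg, if_neg (by omega), if_pos rfl])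
      (by rw [hυreg, if_neg (by omega), if_neg (by omega), if_neg (by omega), if_pos rfl])
    refine ⟨_, τ', .loop_pos (by omega) hbody hr', ?_, hf.trans hτ', ?_⟩
    · rw [Nat.succ_mul]
      simp only at ht
      omega
    · rw [hv', Nat.succ_add_eq_add_succ]

/-- At unit cost the time bound of the body is uniform in the counter and the accumulator, however
large the latter grows, so the number of rounds simply multiplies it. -/
theorem Computes.fold {s : Γ → ℕ → ℕ → ℕ} (hf : C.Computes f)
    (hs : C.ext.Computes (fun γ => s γ.1 γ.2.1 γ.2.2)) :
    C.Computes (fun γ => Ctx.fold (C.size γ) (f γ) (s γ)) := by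
  intro pos k hk hpos
  obtain ⟨p, q, hp⟩ := hf pos k hk hpos
  obtain ⟨p', q', hp'⟩ := hs (fun j => if j < C.len then pos j else
      if j = C.len then k + 1 else k + 2) (k + 3) (by omega) (by
    intro j hj
    split_ifs with h₁ h₂
    · exact (hpos j h₁).trans (by omega)
    · omega
    · omega)
  refine ⟨.seq p (.seq (.move (k + 2) k) (.seq (.const (k + 1) 0) (.seq (.move k 0) (.seq
    (.loop k (.seq p' (.seq (.move (k + 2) (k + 3)) (.seq (.const (k + 3) 1)
      (.seq (.add (k + 1) (k + 1) (k + 3)) (.sub k k (k + 3))))))) (.move k (k + 2)))))),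
    q + Polynomial.X * (q' + 5) + 5, fun γ σ hσ => ?_⟩
  obtain ⟨t, τ, hr, ht, hτ, hv⟩ := hp γ σ hσ
  have hτ0 : τ.reg 0 = C.size γ := (hτ.reg 0 hk).trans hσ.size
  have hf : Frame k σ (((τ.setReg (k + 2) (τ.reg k)).setReg (k + 1) 0).setReg k (C.size γ)) :=
    ((hτ.setReg (by omega) _).setReg (by omega) _).setReg le_rfl _
  obtain ⟨t', τ', hr', ht', hτ', hv'⟩ := runs_fold_loop hk hpos hp' γ (f γ) (C.size γ) 0 _
    (hσ.frame hk hpos hf) (by simp [State.reg_setReg]) (by simp [State.reg_setReg])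
    (by simp [State.reg_setReg, hv, fold_zero])
  have hm := Runs.move k 0 ((τ.setReg (k + 2) (τ.reg k)).setReg (k + 1) 0)
  rw [show ((τ.setReg (k + 2) (τ.reg k)).setReg (k + 1) 0).reg 0 = C.size γ by
    simp [State.reg_setReg, hτ0]] at hm
  refine ⟨_, _, .seq hr (.seq (.move (k + 2) k τ) (.seq (.const (k + 1) 0 _) (.seq hm
    (.seq hr' (.move k (k + 2) τ'))))), ?_, ?_, ?_⟩
  · simp only [Polynomial.eval_add, Polynomial.eval_mul, Polynomial.eval_X,
      Polynomial.eval_ofNat]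
    omega
  · exact (hf.trans hτ').setReg le_rfl _
  · rw [State.reg_setReg, if_pos rfl, hv', zero_add]

/-! ### Decidable properties -/

open Classical in
/-- The characteristic function of `P` is computed in polynomial time. -/
def Decides (C : Ctx Γ) (P : Γ → Prop) : Prop := C.Computes (fun γ => if P γ then 1 else 0)

variable {P Q : Γ → Prop}

theorem Decides.congr (hP : C.Decides P) (h : ∀ γ, P γ ↔ Q γ) : C.Decides Q := by
  have : P = Q := funext fun γ => propext (h γ)
  rwa [← this]

theorem Computes.congr (hf : C.Computes f) (h : ∀ γ, f γ = g γ) : C.Computes g := by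
  have : f = g := funext h
  rwa [← this]

open Classical in
theorem Decides.ite (hP : C.Decides P) (hf : C.Computes f) (hg : C.Computes g) :
    C.Computes (fun γ => if P γ then f γ else g γ) :=
  (Computes.cond hP hf hg).congr fun γ => by by_cases h : P γ <;> simp [h]

open Classical in
theorem Decides.not (hP : C.Decides P) : C.Decides (fun γ => ¬ P γ) :=
  (hP.ite (computes_const 0) (computes_const 1)).congr fun γ => by by_cases h : P γ <;> simp [h]

open Classical in
theorem Decides.and (hP : C.Decides P) (hQ : C.Decides Q) : C.Decides (fun γ => P γ ∧ Q γ) :=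
  (hP.ite hQ (computes_const 0)).congr fun γ => by by_cases h : P γ <;> simp [h]

theorem Decides.or (hP : C.Decides P) (hQ : C.Decides Q) : C.Decides (fun γ => P γ ∨ Q γ) :=
  (hP.not.and hQ.not).not.congr fun γ => by tauto

theorem Decides.imp (hP : C.Decides P) (hQ : C.Decides Q) : C.Decides (fun γ => P γ → Q γ) :=
  (hP.and hQ.not).not.congr fun γ => by tauto

theorem Computes.lt (hf : C.Computes f) (hg : C.Computes g) : C.Decides (fun γ => f γ < g γ) :=
  ((hg.sub hf).cond (computes_const 1) (computes_const 0)).congr fun γ => by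
    by_cases h : f γ < g γ
    · rw [if_neg (by omega), if_pos h]
    · rw [if_pos (by omega), if_neg h]

theorem Computes.le (hf : C.Computes f) (hg : C.Computes g) : C.Decides (fun γ => f γ ≤ g γ) :=
  (hg.lt hf).not.congr fun _ => not_lt

theorem Computes.eq (hf : C.Computes f) (hg : C.Computes g) : C.Decides (fun γ => f γ = g γ) :=
  ((hf.le hg).and (hg.le hf)).congr fun _ => le_antisymm_iff.symm

theorem Decides.exists_lt {R : Γ → ℕ → Prop} (hR : C.ext.Decides (fun γ => R γ.1 γ.2.1)) :
    C.Decides (fun γ => ∃ i < C.size γ, R γ i) := by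
  classical
  refine (Computes.fold (f := fun _ => 0) (s := fun γ i a => if R γ i then 1 else a)
    (computes_const 0) ((hR.ite (computes_const 1) computes_snd).congr fun γ => ?_)).congr
    fun γ => ?_
  · congr
  · have : ∀ n, Ctx.fold n 0 (fun i a => if R γ i then 1 else a) =
        if ∃ i < n, R γ i then 1 else 0 := by
      intro n
      induction n with
      | zero => simp [fold_zero]
      | succ n ih =>
        rw [fold_succ, ih]
        simp only [Order.lt_add_one_iff, Nat.le_iff_lt_or_eq, or_and_right, exists_or,
          exists_eq_left]
        by_cases h₁ : R γ n <;> simp [h₁]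
    rw [this]
    congr

theorem Decides.forall_lt {R : Γ → ℕ → Prop} (hR : C.ext.Decides (fun γ => R γ.1 γ.2.1)) :
    C.Decides (fun γ => ∀ i < C.size γ, R γ i) :=
  (Decides.exists_lt (R := fun γ i => ¬ R γ i) hR.not).not.congr fun γ => by simp

end Ctx


open Ctx

/-! ### Finite sets of numbers as bit masks -/

theorem fold_congr {a n : ℕ} {s s' : ℕ → ℕ → ℕ} (h : ∀ i < n, ∀ b, s i b = s' i b) :
    fold n a s = fold n a s' := by
  induction n with
  | zero => rfl
  | succ n ih =>
    rw [fold_succ, fold_succ, ih fun i hi => h i (by omega), h n (by omega)]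

/-- The power `2 ^ i` for `i ≤ n`, obtained by doubling. -/
def powTwo (n i : ℕ) : ℕ :=
  fold n 1 fun k b => if k < i then b + b else b

/-- The loop always runs `n` rounds, and doubling stops after `i` of them; hence the bound on `i`.
-/
theorem powTwo_eq {n i : ℕ} (h : i ≤ n) : powTwo n i = 2 ^ i := by
  have : ∀ n, powTwo n i = 2 ^ min i n := by
    intro n
    induction n with
    | zero => simp [powTwo, fold_zero]
    | succ n ih =>
      rw [powTwo, fold_succ]
      rw [powTwo] at ih
      rw [ih]
      by_cases hn : n < i
      · rw [if_pos hn, min_eq_right hn.le, min_eq_right (by omega), pow_succ]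
        omega
      · rw [if_neg hn, min_eq_left (by omega), min_eq_left (by omega)]
  rw [this, min_eq_left h]

/-- The bit mask of the set of all `i < m` with `P i`. -/
noncomputable def mask (m : ℕ) (P : ℕ → Prop) : ℕ :=
  open Classical in fold m 0 fun k b => if P k then b + 2 ^ k else b

theorem mask_succ_of_pos {m : ℕ} {P : ℕ → Prop} (h : P m) : mask (m + 1) P = mask m P + 2 ^ m := by
  rw [mask, fold_succ, if_pos h, mask]

theorem mask_succ_of_neg {m : ℕ} {P : ℕ → Prop} (h : ¬ P m) : mask (m + 1) P = mask m P := by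
  rw [mask, fold_succ, if_neg h, mask]

theorem mask_lt (m : ℕ) (P : ℕ → Prop) : mask m P < 2 ^ m := by
  induction m with
  | zero => simp [mask, fold_zero]
  | succ m ih =>
    rw [pow_succ]
    by_cases h : P m
    · rw [mask_succ_of_pos h]; omega
    · rw [mask_succ_of_neg h]; omega

/-- The lower bits add up to less than `2 ^ m`, so the top bit is read off by a comparison, without
division or shifts. -/
theorem le_mask_succ_iff (m : ℕ) (P : ℕ → Prop) : 2 ^ m ≤ mask (m + 1) P ↔ P m := by
  have := mask_lt m P
  by_cases h : P m
  · rw [mask_succ_of_pos h]; simp [h]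
  · rw [mask_succ_of_neg h]; simpa [h] using this

theorem mask_congr {m : ℕ} {P Q : ℕ → Prop} (h : ∀ i < m, P i ↔ Q i) : mask m P = mask m Q := by
  refine fold_congr fun i hi b => ?_
  by_cases hP : P i
  · rw [if_pos hP, if_pos ((h i hi).1 hP)]
  · rw [if_neg hP, if_neg fun hQ => hP ((h i hi).2 hQ)]

/-- The bit mask, with the powers computed by doubling. -/
noncomputable def mask' (n : ℕ) (P : ℕ → Prop) : ℕ :=
  open Classical in fold n 0 fun k b => if P k then b + powTwo n k else b

theorem mask'_eq (n : ℕ) (P : ℕ → Prop) : mask' n P = mask n P :=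
  fold_congr fun i hi b => by rw [powTwo_eq hi.le]

/-- The number `i` belongs to the set with bit mask `a`. -/
def Bit (n a i : ℕ) : Prop :=
  powTwo n i ≤ fold n a fun k b =>
    if i < n - 1 - k ∧ powTwo n (n - 1 - k) ≤ b then b - powTwo n (n - 1 - k) else b

theorem bit_mask_iff {n i : ℕ} (hi : i < n) (P : ℕ → Prop) : Bit n (mask n P) i ↔ P i := by
  -- After `k` rounds the bits from `n - 1` down to `n - k` are stripped, except that stripping
  -- stops above bit `i`, which thus ends up as the top bit.
  have key : ∀ k ≤ n, (fold k (mask n P) fun k b =>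
      if i < n - 1 - k ∧ powTwo n (n - 1 - k) ≤ b then b - powTwo n (n - 1 - k) else b) =
      mask (max (n - k) (i + 1)) P := by
    intro k
    induction k with
    | zero =>
      intro _
      rw [fold_zero, tsub_zero, max_eq_left (by omega)]
    | succ k ih =>
      intro hk
      rw [fold_succ, ih (by omega)]
      by_cases hik : i < n - 1 - k
      · obtain ⟨j, hj⟩ : ∃ j, n - 1 - k = j := ⟨_, rfl⟩
        rw [hj] at hik ⊢
        rw [powTwo_eq (by omega), max_eq_left (by omega), max_eq_left (by omega),
          show n - k = j + 1 by omega, show n - (k + 1) = j by omega]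
        by_cases hP : P j
        · rw [if_pos ⟨hik, (le_mask_succ_iff j P).2 hP⟩, mask_succ_of_pos hP, Nat.add_sub_cancel]
        · rw [if_neg fun h => hP ((le_mask_succ_iff j P).1 h.2), mask_succ_of_neg hP]
      · rw [if_neg fun h => hik h.1, max_eq_right (by omega), max_eq_right (by omega)]
  rw [← le_mask_succ_iff i P, Bit, powTwo_eq hi.le]
  have := key n le_rfl
  rw [Nat.sub_self, Nat.zero_max] at this
  rw [← this]

/-- The parity of the number of `i < n` with `P i`. -/
noncomputable def parity (n : ℕ) (P : ℕ → Prop) : ℕ :=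
  open Classical in fold n 0 fun k b => if P k then 1 - b else b

theorem parity_lt_two (n : ℕ) (P : ℕ → Prop) : parity n P < 2 := by
  induction n with
  | zero => simp [parity, fold_zero]
  | succ n ih =>
    rw [parity, fold_succ, ← parity]
    split_ifs <;> omega

open Classical in
theorem parity_cast (n : ℕ) (P : ℕ → Prop) :
    (parity n P : ZMod 2) = ∑ i : Fin n, if P i then 1 else 0 := by
  induction n with
  | zero => simp [parity, fold_zero]
  | succ n ih =>
    rw [parity, fold_succ, ← parity, Fin.sum_univ_castSucc]
    simp only [Fin.val_castSucc, Fin.val_last, ← ih]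
    have h2 := parity_lt_two n P
    generalize parity n P = a at h2
    by_cases h : P n
    · rw [if_pos h, if_pos h]
      interval_cases a <;> decide
    · rw [if_neg h, if_neg h, add_zero]

/-! ### The encoded graph -/

/-- The vertices `i` and `j` are adjacent in the graph encoded in the memory `m`. -/
def MemAdj (n : ℕ) (m : ℕ → ℕ) (i j : ℕ) : Prop := m (n + 1 + n * i + j) = 1

/-- The vertex `i` is an endpoint of the edge encoded in the memory `m`. -/
def MemEdge (n : ℕ) (m : ℕ → ℕ) (i : ℕ) : Prop := m (n + 1 + n * n + i) = 1

/-- The vertex `i` has value one under the function encoded in the memory `m`. -/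
def MemOne (n : ℕ) (m : ℕ → ℕ) (i : ℕ) : Prop := m (n + 1 + n * n + n + i) = 1

/-- The bit mask of the vertices reachable from a vertex with `P` in at most `t` steps that
avoid `y`. -/
noncomputable def reachMask (n : ℕ) (m : ℕ → ℕ) (P : ℕ → Prop) (y t : ℕ) : ℕ :=
  fold t (mask' n P) fun _ a => mask' n fun j =>
    Bit n a j ∨ ∃ i < n, Bit n a i ∧ MemAdj n m i j ∧ i ≠ y ∧ j ≠ y

/-- The bit mask of the vertices reachable from the edge without meeting `y`. -/
noncomputable def farMask (n : ℕ) (m : ℕ → ℕ) (y : ℕ) : ℕ :=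
  reachMask n m (fun j => MemEdge n m j ∧ j ≠ y) y n

/-- The bit mask of the component of `s`. -/
noncomputable def componentMask (n : ℕ) (m : ℕ → ℕ) (s : ℕ) : ℕ :=
  reachMask n m (fun j => j = s) n n

/-- What the algorithm tests. -/
def Accepts (n : ℕ) (m : ℕ → ℕ) : Prop :=
  (∀ s < n, parity n (fun k => Bit n (componentMask n m s) k ∧ MemOne n m k) = 0) ∧
    ∃ x < n, (∀ y < n, y ≠ x → Bit n (farMask n m y) x) ∧
      ¬ (parity n (fun k => ¬ Bit n (farMask n m x) k ∧ MemOne n m k) = 1 ↔ MemEdge n m x)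

section Complexity

variable {Γ : Type} {C : Ctx Γ} {f g : Γ → ℕ}

/-! ### Running time of the acceptance test -/

theorem computes_powTwo (hf : C.Computes f) : C.Computes (fun γ => powTwo (C.size γ) (f γ)) :=
  Computes.fold (computes_const 1)
    (((computes_fst.lt hf.weaken).ite (computes_snd.add computes_snd) computes_snd).congr
      fun γ => by congr)

theorem computes_mask' {P : Γ → ℕ → Prop} (hP : C.ext.Decides (fun γ => P γ.1 γ.2.1)) :
    C.Computes (fun γ => mask' (C.size γ) (P γ)) :=
  Computes.fold (computes_const 0)
    (hP.ite (computes_snd.add (computes_powTwo computes_fst)) computes_snd)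

theorem computes_parity {P : Γ → ℕ → Prop} (hP : C.ext.Decides (fun γ => P γ.1 γ.2.1)) :
    C.Computes (fun γ => parity (C.size γ) (P γ)) :=
  Computes.fold (computes_const 0) (hP.ite ((computes_const 1).sub computes_snd) computes_snd)

theorem decides_bit (hf : C.Computes f) (hg : C.Computes g) :
    C.Decides (fun γ => Bit (C.size γ) (f γ) (g γ)) := by
  have hk : C.ext.Computes (fun γ => C.size γ.1 - 1 - γ.2.1) :=
    (computes_size.sub (computes_const 1)).sub computes_fst
  have hp : C.ext.Computes (fun γ => powTwo (C.size γ.1) (C.size γ.1 - 1 - γ.2.1)) :=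
    computes_powTwo hk
  exact (computes_powTwo hg).le (Computes.fold hf
    ((((hg.weaken.lt hk).and (hp.le computes_snd)).ite (computes_snd.sub hp) computes_snd).congr
      fun γ => by congr))

/-- Multiplication by the size is repeated addition, which is all that the matrix addresses need. -/
theorem computes_size_mul (hf : C.Computes f) : C.Computes (fun γ => C.size γ * f γ) := by
  refine (Computes.fold (s := fun γ _ b => b + f γ) (computes_const 0)
    (computes_snd.add hf.weaken)).congr fun γ => ?_
  generalize C.size γ = n
  induction n with
  | zero => rw [fold_zero, zero_mul]
  | succ n ih => rw [fold_succ, ih, Nat.succ_mul]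

theorem decides_memAdj (hf : C.Computes f) (hg : C.Computes g) :
    C.Decides (fun γ => MemAdj (C.size γ) (C.mem γ) (f γ) (g γ)) :=
  ((((computes_size.add (computes_const 1)).add (computes_size_mul hf)).add hg).read).eq
    (computes_const 1)

theorem decides_memEdge (hf : C.Computes f) :
    C.Decides (fun γ => MemEdge (C.size γ) (C.mem γ) (f γ)) :=
  ((((computes_size.add (computes_const 1)).add (computes_size_mul computes_size)).add hf).read).eq
    (computes_const 1)

theorem decides_memOne (hf : C.Computes f) :
    C.Decides (fun γ => MemOne (C.size γ) (C.mem γ) (f γ)) :=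
  (((((computes_size.add (computes_const 1)).add (computes_size_mul computes_size)).add
    computes_size).add hf).read).eq (computes_const 1)

theorem computes_reachMask {P : Γ → ℕ → Prop} (hP : C.ext.Decides (fun γ => P γ.1 γ.2.1))
    (hf : C.Computes f) :
    C.Computes (fun γ => reachMask (C.size γ) (C.mem γ) (P γ) (f γ) (C.size γ)) := by
  refine Computes.fold (s := fun γ _ a => mask' (C.size γ) fun j => Bit (C.size γ) a j ∨
    ∃ i < C.size γ, Bit (C.size γ) a i ∧ MemAdj (C.size γ) (C.mem γ) i j ∧ i ≠ f γ ∧ j ≠ f γ)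
    (computes_mask' hP) ?_
  refine computes_mask' (C := C.ext) (P := fun γ j => Bit (C.size γ.1) γ.2.2 j ∨
    ∃ i < C.size γ.1, Bit (C.size γ.1) γ.2.2 i ∧ MemAdj (C.size γ.1) (C.mem γ.1) i j ∧
      i ≠ f γ.1 ∧ j ≠ f γ.1) ?_
  have ha : C.ext.ext.Computes (fun γ => γ.1.2.2) := computes_snd.weaken
  refine (decides_bit ha computes_fst).or ?_
  refine Decides.exists_lt (C := C.ext.ext) (R := fun γ i => Bit (C.size γ.1.1) γ.1.2.2 i ∧
    MemAdj (C.size γ.1.1) (C.mem γ.1.1) i γ.2.1 ∧ i ≠ f γ.1.1 ∧ γ.2.1 ≠ f γ.1.1) ?_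
  have hj : C.ext.ext.ext.Computes (fun γ => γ.1.2.1) := computes_fst.weaken
  have hy : C.ext.ext.ext.Computes (fun γ => f γ.1.1.1) := hf.weaken.weaken.weaken
  exact (decides_bit ha.weaken computes_fst).and ((decides_memAdj computes_fst hj).and
    ((computes_fst.eq hy).not.and (hj.eq hy).not))

theorem computes_farMask (hf : C.Computes f) :
    C.Computes (fun γ => farMask (C.size γ) (C.mem γ) (f γ)) :=
  computes_reachMask (P := fun γ j => MemEdge (C.size γ) (C.mem γ) j ∧ j ≠ f γ)
    ((decides_memEdge computes_fst).and (computes_fst.eq hf.weaken).not) hf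

theorem computes_componentMask (hf : C.Computes f) :
    C.Computes (fun γ => componentMask (C.size γ) (C.mem γ) (f γ)) :=
  computes_reachMask (P := fun γ j => j = f γ) (computes_fst.eq hf.weaken) computes_size

theorem decides_accepts : C.Decides (fun γ => Accepts (C.size γ) (C.mem γ)) := by
  refine Decides.and ?_ ?_
  · refine Decides.forall_lt (R := fun γ s => parity (C.size γ) (fun k =>
      Bit (C.size γ) (componentMask (C.size γ) (C.mem γ) s) k ∧
        MemOne (C.size γ) (C.mem γ) k) = 0) ?_
    refine Computes.eq ?_ (computes_const 0)
    refine computes_parity (C := C.ext) (P := fun γ k =>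
      Bit (C.size γ.1) (componentMask (C.size γ.1) (C.mem γ.1) γ.2.1) k ∧
        MemOne (C.size γ.1) (C.mem γ.1) k) ?_
    have hs : C.ext.ext.Computes (fun γ => γ.1.2.1) := computes_fst.weaken
    exact (decides_bit (computes_componentMask hs) computes_fst).and (decides_memOne computes_fst)
  · refine Decides.exists_lt (R := fun γ x => (∀ y < C.size γ, y ≠ x →
      Bit (C.size γ) (farMask (C.size γ) (C.mem γ) y) x) ∧ ¬ (parity (C.size γ) (fun k =>
        ¬ Bit (C.size γ) (farMask (C.size γ) (C.mem γ) x) k ∧ MemOne (C.size γ) (C.mem γ) k) = 1 ↔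
          MemEdge (C.size γ) (C.mem γ) x)) ?_
    refine Decides.and ?_ (Decides.not ?_)
    · refine Decides.forall_lt (C := C.ext) (R := fun γ y => y ≠ γ.2.1 →
        Bit (C.size γ.1) (farMask (C.size γ.1) (C.mem γ.1) y) γ.2.1) ?_
      have hx : C.ext.ext.Computes (fun γ => γ.1.2.1) := computes_fst.weaken
      exact (computes_fst.eq hx).not.imp (decides_bit (computes_farMask computes_fst) hx)
    · have hpar : C.ext.Computes (fun γ => parity (C.size γ.1) (fun k =>
          ¬ Bit (C.size γ.1) (farMask (C.size γ.1) (C.mem γ.1) γ.2.1) k ∧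
            MemOne (C.size γ.1) (C.mem γ.1) k)) := by
        refine computes_parity (C := C.ext) (P := fun γ k =>
          ¬ Bit (C.size γ.1) (farMask (C.size γ.1) (C.mem γ.1) γ.2.1) k ∧
            MemOne (C.size γ.1) (C.mem γ.1) k) ?_
        have hs : C.ext.ext.Computes (fun γ => γ.1.2.1) := computes_fst.weaken
        exact (decides_bit (computes_farMask hs) computes_fst).not.and
          (decides_memOne computes_fst)
      have h₁ := hpar.eq (computes_const 1)
      have h₂ : C.ext.Decides (fun γ => MemEdge (C.size γ.1) (C.mem γ.1) γ.2.1) :=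
        decides_memEdge computes_fst
      exact ((h₁.imp h₂).and (h₂.imp h₁)).congr fun γ => iff_def.symm

end Complexity

/-! ### From computable predicates to decision problems -/

/-- Scanning to the first zero cell recovers the unary number: register `1` is the address, register
`2` the cell just read, register `3` the constant one. -/
theorem runs_count_loop (σ : State) (n : ℕ) (h₁ : ∀ i < n, σ.mem i ≠ 0) (h₀ : σ.mem n = 0)
    (m : ℕ) : ∀ (i : ℕ) (τ : State), i + m = n → τ.mem = σ.mem → τ.reg 1 = i →
      τ.reg 2 = σ.mem i → ∃ (t : ℕ) (υ : State),
        Runs (.loop 2 (.seq (.const 3 1) (.seq (.add 1 1 3) (.load 2 1)))) τ t υ ∧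
        t ≤ m * 4 + 1 ∧ υ.mem = σ.mem ∧ υ.reg 1 = n := by
  induction m with
  | zero =>
    intro i τ hi hm hr₁ hr₂
    obtain rfl : i = n := by omega
    exact ⟨1, τ, .loop_zero (hr₂.trans h₀), by omega, hm, hr₁⟩
  | succ m ih =>
    intro i τ hi hm hr₁ hr₂
    have hbody := Runs.seq (.const 3 1 τ) (.seq (.add 1 1 3 _) (.load 2 1 _))
    generalize hρ : State.setReg _ 2 _ = ρ at hbody
    obtain ⟨t, υ, hr, ht, hυ⟩ := ih (i + 1) ρ (by omega) (by rw [← hρ]; exact hm)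
      (by rw [← hρ]; simp [State.reg_setReg, hr₁])
      (by rw [← hρ]; simp [State.reg_setReg, State.mem_setReg, hr₁, hm])
    exact ⟨_, υ, .loop_pos (by rw [hr₂]; exact h₁ i (by omega)) hbody hr, by omega, hυ⟩

theorem eval_mono (q : Polynomial ℕ) {a b : ℕ} (h : a ≤ b) : q.eval a ≤ q.eval b := by
  rw [Polynomial.eval_eq_sum, Polynomial.eval_eq_sum]
  exact Finset.sum_le_sum fun i _ => Nat.mul_le_mul_left _ (Nat.pow_le_pow_left h i)

/-- A decision problem is solvable in polynomial time if every encoding begins with a unary number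
and the answer is a computable predicate of this number and the memory. -/
theorem polyTimeDecidable_of_decides {α : Type} {enc : α → List Bool} {P : α → Prop}
    {size : α → ℕ} (hle : ∀ a, size a ≤ (enc a).length)
    (h₁ : ∀ a, ∀ i < size a, (initial (enc a)).mem i ≠ 0)
    (h₀ : ∀ a, (initial (enc a)).mem (size a) = 0)
    (hP : Ctx.Decides ⟨size, fun a => (initial (enc a)).mem, 0, fun _ _ => 0⟩ P) :
    PolyTimeDecidable enc P := by
  obtain ⟨p, q, hp⟩ := hP (fun _ => 0) 1 one_pos (fun j hj => absurd hj (Nat.not_lt_zero j))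
  -- Register `0` initially holds the input length; the scan replaces it by the size. The answer
  -- appears in register `1`, the first free one, and is moved to register `0`.
  refine ⟨.seq (.const 1 0) (.seq (.load 2 1) (.seq
    (.loop 2 (.seq (.const 3 1) (.seq (.add 1 1 3) (.load 2 1)))) (.seq (.move 0 1)
      (.seq p (.move 0 1))))), q + 4 * Polynomial.X + 5, fun a => ?_⟩
  obtain ⟨t, τ, hr, ht, hm, hτ⟩ := runs_count_loop (initial (enc a)) (size a) (h₁ a) (h₀ a)
    (size a) 0 ((((initial (enc a)).setReg 1 0)).setReg 2
      (((initial (enc a)).setReg 1 0).mem (((initial (enc a)).setReg 1 0).reg 1)))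
    (by omega) rfl (by simp [State.reg_setReg]) (by simp [State.reg_setReg, State.mem_setReg])
  obtain ⟨t', τ', hr', ht', -, hv⟩ := hp a (τ.setReg 0 (τ.reg 1))
    ⟨by simp [State.reg_setReg, hτ], hm, fun j hj => absurd hj (Nat.not_lt_zero j)⟩
  refine ⟨_, _, .seq (.const 1 0 _) (.seq (.load 2 1 _) (.seq hr (.seq (.move 0 1 τ)
    (.seq hr' (.move 0 1 τ'))))), ?_, ?_, ?_⟩
  · have h := eval_mono q (hle a)
    have h' := hle a
    simp only [Polynomial.eval_add, Polynomial.eval_mul, Polynomial.eval_X,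
      Polynomial.eval_ofNat]
    simp only at ht'
    omega
  · intro ha
    rw [State.reg_setReg, if_pos rfl, hv]
    exact if_pos ha
  · intro ha
    rw [State.reg_setReg, if_pos rfl, hv]
    exact if_neg ha

end Ram

/-! ### Correctness of the algorithm -/

namespace Ram

/-! ### Positions in the encoding -/

theorem length_flatMap_const {α : Type*} (l : List α) (g : α → List Bool) (n : ℕ)
    (hg : ∀ a ∈ l, (g a).length = n) : (l.flatMap g).length = l.length * n := by
  induction l with
  | nil => simp
  | cons a l ih =>
    rw [List.flatMap_cons, List.length_append, hg a (by simp),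
      ih fun b hb => hg b (List.mem_cons_of_mem a hb), List.length_cons, Nat.succ_mul, add_comm]

theorem getD_flatMap {α : Type*} (l : List α) (g : α → List Bool) (n : ℕ)
    (hg : ∀ a ∈ l, (g a).length = n) (i : ℕ) (hi : i < l.length) (j : ℕ) (hj : j < n) :
    (l.flatMap g).getD (n * i + j) false = (g l[i]).getD j false := by
  induction l generalizing i with
  | nil => simp at hi
  | cons a l ih =>
    have ha : (g a).length = n := hg a (by simp)
    rw [List.flatMap_cons]
    cases i with
    | zero =>
      rw [List.getD_append _ _ _ _ (by rw [ha]; simpa using hj)]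
      simp
    | succ i =>
      rw [List.getD_append_right _ _ _ _ (by rw [ha, Nat.mul_succ]; omega), ha,
        show n * (i + 1) + j - n = n * i + j by rw [Nat.mul_succ]; omega,
        ih (fun b hb => hg b (List.mem_cons_of_mem a hb)) i (by simpa using hi)]
      simp

theorem getD_map_finRange {n : ℕ} (g : Fin n → Bool) (i : Fin n) :
    ((List.finRange n).map g).getD i false = g i := by
  simp [List.getD_eq_getElem?_getD]

end Ram

namespace ForestInstance

open Ram

/-- The memory in which the encoded instance is presented. -/
noncomputable def memory (I : ForestInstance) : ℕ → ℕ := (initial I.encode).mem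

theorem memory_eq (I : ForestInstance) (i : ℕ) : I.memory i = (I.encode.getD i false).toNat := rfl

theorem toNat_eq_one_iff (b : Bool) : b.toNat = 1 ↔ b = true := by cases b <;> simp

theorem length_adjacency {n : ℕ} (g : Fin n → Fin n → Bool) :
    ((List.finRange n).flatMap fun i => (List.finRange n).map (g i)).length = n * n := by
  rw [length_flatMap_const _ _ n (by simp), List.length_finRange]

theorem n_le_length (I : ForestInstance) : I.n ≤ I.encode.length := by
  simp only [encode, List.length_append, List.length_replicate]
  omega

theorem memory_unary (I : ForestInstance) {i : ℕ} (hi : i < I.n) : I.memory i = 1 := by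
  rw [memory_eq, toNat_eq_one_iff, encode]
  simp only [List.append_assoc]
  rw [List.getD_append _ _ _ _ (by simpa using hi)]
  simp [List.getD_eq_getElem?_getD, hi]

theorem memory_n (I : ForestInstance) : I.memory I.n = 0 := by
  rw [memory_eq, encode]
  simp only [List.append_assoc]
  rw [List.getD_append_right _ _ _ _ (by simp)]
  simp

open Classical in
theorem memAdj_iff (I : ForestInstance) (i j : Fin I.n) :
    MemAdj I.n I.memory i j ↔ I.graph.Adj i j := by
  have hlt : I.n * i + j < I.n * I.n :=
    calc I.n * i + j < I.n * i + I.n := by omega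
      _ = I.n * (i + 1) := (Nat.mul_succ _ _).symm
      _ ≤ I.n * I.n := Nat.mul_le_mul_left _ i.2
  rw [MemAdj, memory_eq, toNat_eq_one_iff, encode,
    List.append_assoc, List.append_assoc, List.getD_append_right _ _ _ _ (by simp; omega),
    List.getD_append _ _ _ _ (by
      rw [length_adjacency]
      simp only [List.length_append, List.length_replicate, List.length_singleton]
      omega),
    show I.n + 1 + I.n * i + j - (List.replicate I.n true ++ [false]).length = I.n * i + j by
      simp only [List.length_append, List.length_replicate, List.length_singleton]
      omega,
    getD_flatMap _ _ I.n (by simp) i (by simp) j j.2]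
  simp

open Classical in
theorem memEdge_iff (I : ForestInstance) (i : Fin I.n) :
    MemEdge I.n I.memory i ↔ i ∈ I.edge := by
  rw [MemEdge, memory_eq, toNat_eq_one_iff, encode,
    List.getD_append _ _ _ _ (by
      simp only [List.length_append, List.length_replicate, List.length_singleton,
        length_adjacency, List.length_map, List.length_finRange]
      omega),
    List.getD_append_right _ _ _ _ (by
      simp only [List.length_append, List.length_replicate, List.length_singleton,
        length_adjacency]
      omega)]
  rw [List.length_append, length_adjacency]
  simp only [List.length_append, List.length_replicate, List.length_singleton,
    Nat.add_sub_cancel_left, getD_map_finRange, decide_eq_true_eq]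

open Classical in
theorem memOne_iff (I : ForestInstance) (i : Fin I.n) :
    MemOne I.n I.memory i ↔ I.f i = 1 := by
  rw [MemOne, memory_eq, toNat_eq_one_iff, encode,
    List.getD_append_right _ _ _ _ (by
      simp only [List.length_append, List.length_replicate, List.length_singleton,
        length_adjacency, List.length_map, List.length_finRange]
      omega)]
  rw [List.length_append, List.length_append, length_adjacency]
  simp only [List.length_append, List.length_replicate, List.length_singleton, List.length_map,
    List.length_finRange, Nat.add_sub_cancel_left, getD_map_finRange, decide_eq_true_eq]

/-! ### Search masks and reachability -/

theorem reachMask_eq {n : ℕ} {m : ℕ → ℕ} {P : ℕ → Prop} {y : ℕ} {H : SimpleGraph (Fin n)}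
    (hH : ∀ i j : Fin n, H.Adj i j ↔ MemAdj n m i j ∧ (i : ℕ) ≠ y ∧ (j : ℕ) ≠ y) (t : ℕ) :
    reachMask n m P y t = mask n fun j =>
      ∃ (hj : j < n) (a : Fin n), P a ∧ ∃ w : H.Walk ⟨j, hj⟩ a, w.length ≤ t := by
  induction t with
  | zero =>
    rw [reachMask, Ctx.fold_zero, mask'_eq]
    refine mask_congr fun j hj => ⟨fun h => ⟨hj, ⟨j, hj⟩, h, .nil, le_rfl⟩, ?_⟩
    rintro ⟨_, a, ha, w, hw⟩
    have := SimpleGraph.Walk.eq_of_length_eq_zero (Nat.le_zero.1 hw)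
    rw [← this] at ha
    exact ha
  | succ t ih =>
    rw [reachMask, Ctx.fold_succ, ← reachMask, ih, mask'_eq]
    refine mask_congr fun j hj => ?_
    rw [bit_mask_iff hj]
    constructor
    · rintro (⟨_, a, ha, w, hw⟩ | ⟨i, hi, hb, hadj⟩)
      · exact ⟨hj, a, ha, w, hw.trans (by omega)⟩
      · rw [bit_mask_iff hi] at hb
        obtain ⟨_, a, ha, w, hw⟩ := hb
        exact ⟨hj, a, ha, .cons ((hH ⟨i, hi⟩ ⟨j, hj⟩).2 hadj).symm w, by simpa using hw⟩
    · rintro ⟨_, a, ha, w, hw⟩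
      cases w with
      | nil => exact Or.inl ⟨hj, _, ha, .nil, by simp⟩
      -- Walks run from the reached vertex back to a source, so their first edge is the one added in
      -- the last round.
      | @cons _ b _ hadj w =>
        refine Or.inr ⟨b, b.2, (bit_mask_iff b.2 _).2 ⟨b.2, a, ha, w, by simpa using hw⟩, ?_⟩
        exact (hH b ⟨j, hj⟩).1 hadj.symm

/-- A reachable vertex is reached by a path, which has fewer than `n` edges, so `n` rounds suffice.
-/
theorem bit_reachMask_iff {n : ℕ} {m : ℕ → ℕ} {P : ℕ → Prop} {y : ℕ} {H : SimpleGraph (Fin n)}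
    (hH : ∀ i j : Fin n, H.Adj i j ↔ MemAdj n m i j ∧ (i : ℕ) ≠ y ∧ (j : ℕ) ≠ y) (j : Fin n) :
    Bit n (reachMask n m P y n) j ↔ ∃ a : Fin n, P a ∧ H.Reachable a j := by
  rw [reachMask_eq hH, bit_mask_iff j.2]
  constructor
  · rintro ⟨_, a, ha, w, -⟩
    exact ⟨a, ha, w.reachable.symm⟩
  · rintro ⟨a, ha, h⟩
    obtain ⟨w, hw⟩ := h.symm.exists_isPath
    exact ⟨j.2, a, ha, w, by simpa using hw.length_lt.le⟩

open ParityForest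

theorem bit_componentMask_iff (I : ForestInstance) (s w : Fin I.n) :
    Bit I.n (componentMask I.n I.memory s) w ↔ I.graph.Reachable s w := by
  rw [componentMask, bit_reachMask_iff (H := I.graph)]
  · constructor
    · rintro ⟨a, ha, h⟩
      rwa [← Fin.ext ha]
    · exact fun h => ⟨s, rfl, h⟩
  · intro i j
    rw [memAdj_iff]
    -- The forbidden vertex is `n`, which does not exist, so nothing is deleted.
    exact ⟨fun h => ⟨h, by omega, by omega⟩, fun h => h.1⟩

theorem bit_farMask_iff (I : ForestInstance) {u v : Fin I.n} (he : I.edge = s(u, v))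
    (y w : Fin I.n) : Bit I.n (farMask I.n I.memory y) w ↔ Far I.graph u v y w := by
  rw [farMask, bit_reachMask_iff (H := within I.graph {y}ᶜ)]
  · refine exists_congr fun a => ?_
    rw [memEdge_iff, he, Sym2.mem_iff, and_assoc, ne_eq, Fin.val_inj]
  · intro i j
    rw [memAdj_iff, ne_eq, ne_eq, Fin.val_inj, Fin.val_inj]
    rfl

open Classical in
theorem parity_memOne (I : ForestInstance) {P : ℕ → Prop} {Q : Fin I.n → Prop}
    (hPQ : ∀ i : Fin I.n, P i ↔ Q i) :
    ((parity I.n fun k => P k ∧ MemOne I.n I.memory k : ℕ) : ZMod 2) =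
      ∑ w with Q w, residue I.f w := by
  rw [parity_cast, Finset.sum_filter]
  refine Finset.sum_congr rfl fun i _ => ?_
  have h : residue I.f i = if I.f i = 1 then 1 else 0 := by
    rw [residue]
    generalize I.f i = a
    revert a
    decide
  simp only [hPQ, memOne_iff, h, ite_and]

theorem parity_near (I : ForestInstance) {u v : Fin I.n} (he : I.edge = s(u, v)) (x : Fin I.n) :
    ((parity I.n fun k => ¬ Bit I.n (farMask I.n I.memory x) k ∧ MemOne I.n I.memory k : ℕ) :
      ZMod 2) = nearSum I.graph (residue I.f) u v x := by
  rw [nearSum, I.parity_memOne (P := fun k => ¬ Bit I.n (farMask I.n I.memory x) k)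
    (Q := fun w => ¬ Far I.graph u v x w) fun w => not_congr (I.bit_farMask_iff he x w)]
  congr!

theorem cast_parity_eq_zero_iff (n : ℕ) (P : ℕ → Prop) :
    (parity n P : ZMod 2) = 0 ↔ parity n P = 0 := by
  have h := parity_lt_two n P
  generalize parity n P = a at h
  interval_cases a <;> decide

theorem cast_parity_eq_one_iff (n : ℕ) (P : ℕ → Prop) :
    (parity n P : ZMod 2) = 1 ↔ parity n P = 1 := by
  have h := parity_lt_two n P
  generalize parity n P = a at h
  interval_cases a <;> decide

theorem ne_endpoints_iff {V : Type*} (a : ZMod 2) (u v x : V) :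
    a ≠ endpoints u v x ↔ ¬ (a = 1 ↔ x ∈ s(u, v)) := by
  rw [endpoints, Sym2.mem_iff]
  by_cases h : x = u ∨ x = v
  · simp [h]
  · simp only [h, if_false, iff_false]
    revert a
    decide

/-- The two halves of the test are the evenness of all components, needed because the input may be
disconnected, and `Criterion`. -/
theorem accepts_iff (I : ForestInstance) :
    Accepts I.n I.memory ↔ HasForestAvoiding I.graph I.f I.edge := by
  obtain ⟨u, v, he⟩ : ∃ u v, I.edge = s(u, v) := by
    induction h : I.edge using Sym2.ind with
    | _ u v => exact ⟨u, v, rfl⟩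
  have huv : I.graph.Adj u v := by
    have := I.edge_mem
    rwa [he] at this
  rw [he, hasForestAvoiding_iff huv, separable_iff_criterion huv, Accepts]
  refine and_congr ?_ ?_
  · rw [ComponentsEven, ← Fin.forall_iff (p := fun s : Fin I.n => parity I.n (fun k =>
      Bit I.n (componentMask I.n I.memory s) k ∧ MemOne I.n I.memory k) = 0)]
    refine forall_congr' fun s => ?_
    rw [← cast_parity_eq_zero_iff, parity_memOne I (I.bit_componentMask_iff s)]
    congr!
  · rw [Criterion]
    constructor
    · rintro ⟨x, hx, hfar, hne⟩
      refine ⟨⟨x, hx⟩, fun y hy => ?_, ?_⟩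
      · exact (I.bit_farMask_iff he y ⟨x, hx⟩).1 (hfar y y.2 fun h => hy (Fin.ext h))
      · rw [ne_endpoints_iff, ← he, ← I.memEdge_iff, ← I.parity_near he, cast_parity_eq_one_iff]
        exact hne
    · rintro ⟨x, hfar, hne⟩
      refine ⟨x, x.2, fun y hy hyx => ?_, ?_⟩
      · exact (I.bit_farMask_iff he ⟨y, hy⟩ x).2 (hfar _ fun h => hyx (congrArg Fin.val h))
      · rw [ne_endpoints_iff, ← he, ← I.memEdge_iff, ← I.parity_near he, cast_parity_eq_one_iff] at hne
        exact hne

theorem polyTimeDecidable_hasForestAvoiding :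
    PolyTimeDecidable encode (fun I => HasForestAvoiding I.graph I.f I.edge) := by
  refine polyTimeDecidable_of_decides (size := fun I => I.n) n_le_length
    (fun I i hi => ?_) memory_n ?_
  · exact (I.memory_unary hi).trans_ne one_ne_zero
  · exact Ctx.Decides.congr decides_accepts accepts_iff

end ForestInstance

theorem mainTheorem6 :
    -- the decision problem is solvable in polynomial time
    Ram.PolyTimeDecidable ForestInstance.encode
      (fun I => HasForestAvoiding I.graph I.f I.edge) ∧
    -- the reduction at a cut-vertex `x`
    (∀ (V : Type*) [Finite V] (G : SimpleGraph V) (f : V → Fin 2) (e : Sym2 V) (x : V),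
      G.Connected → IsEvenSum f → e ∈ G.edgeSet → IsCutVertex G x →
      (∃! C : (G.induce {x}ᶜ).ConnectedComponent, ∃ w ∈ C.supp, (w : V) ∈ e) ∧
      ∀ C : (G.induce {x}ᶜ).ConnectedComponent, (∃ w ∈ C.supp, (w : V) ∈ e) →
        (attachedSet G x C).ncard < Nat.card V ∧
        (G.induce (attachedSet G x C)).Connected ∧
        ∃ e' ∈ (G.induce (attachedSet G x C)).edgeSet, e'.map Subtype.val = e ∧
        ∃ f' : attachedSet G x C → Fin 2,
          (∀ w : attachedSet G x C, (w : V) ≠ x → f' w = f w) ∧ IsEvenSum f' ∧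
          (HasForestAvoiding G f e ↔
            HasForestAvoiding (G.induce (attachedSet G x C)) f' e')) ∧
    -- the answer in a connected graph without cut-vertices
    (∀ (V : Type*) [Finite V] (G : SimpleGraph V) (f : V → Fin 2) (e : Sym2 V),
      G.Connected → (∀ x, ¬ IsCutVertex G x) → IsEvenSum f → e ∈ G.edgeSet →
      (¬ HasForestAvoiding G f e ↔ ∀ z, f z = 1 ↔ z ∈ e)) := by
  refine ⟨ForestInstance.polyTimeDecidable_hasForestAvoiding, ParityForest.cutVertex_part, ?_⟩
  intro V _ G f e hG hcut hf he
  induction e using Sym2.ind with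
  | _ u v => exact ParityForest.noCutVertex_answer hG hcut hf he
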